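/- For $q,x\in\mathbb C$ with $|q|<1$ put $(x;q)_n=\prod_{k=0}^{n-1}(1-xq^k)$, $(x;q)_\infty=\lim_{n\to\infty}(x;q)_n$, and $(x_1,\dots,x_k;q)_n=(x_1;q)_n\cdots(x_k;q)_n$ for $n\in\mathbb N_0\cup\{\infty\}$; put $\Omega_q=\{q^{-k}:k=0,1,2,\dots\}$. Write $${}_{s+1}\phi_s\!\left({a_1,\dots,a_{s+1}\atop b_1,\dots,b_s};q,z\right)=\sum_{k=0}^\infty\frac{(a_1,\dots,a_{s+1};q)_k}{(q,b_1,\dots,b_s;q)_k}\,z^k\qquad(|z|<1,\ b_j\notin\Omega_q).$$ In lists of parameters, $\pm x$ stands for $x,-x$, $\;q^{\pm\frac12}x$ for $q^{\frac12}x,q^{-\frac12}x$, and a factor behind a parenthesis multiplies every element inside it. **Theorem.** Let $q\in\mathbb C$ with $0<|q|<1$, let $q^{1/2}$ be a square root of $q$ (and $q^{3/2}=(q^{1/2})^3$, $q^{-1/2}=1/q^{1/2}$), and let $a,b,z\in\mathbb C\setminus\{0\}$ with $|z|<1$ and $a^2b^2/q\notin\Omega_q$ (so that all lower parameters of the next three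 series are admissible). Then these series converge and $${}_2\phi_1\!\left({qa^2,qb^2\atop qa^2b^2};q^2,z\right){}_2\phi_1\!\left({\frac{a^2}{q},\frac{b^2}{q}\atop \frac{a^2b^2}{q}};q^2,qz\right)={}_4\phi_3\!\left({a^2,b^2,\pm ab\atop \frac{a^2b^2}{q},\pm q^{\frac12}ab};q,z\right).$$ Moreover, let $f\in\mathbb C\setminus\{0\}$ with $f\ne q^n$ for all $n\in\mathbb Z$, and let $\sigma\in(0,\infty)$ be such that the denominator elements $q^{\pm\frac12}\sigma/w$, $q^{\pm\frac12}a^2w/\sigma$, $q^{-\frac12}b^2w/\sigma$ in the integrand below have modulus less than $1$ when $|w|=1$, and such that $|q^{1/2}z|<\sigma$. Then, with $w=e^{i\psi}$, the ${}_3\phi_2$ below converges for every $\psi$, the integrand is integrable on $[-\pi,\pi]$, and the above product equals $$\frac1{2\pi}\frac{\left(q^2,qa^2,a^2,a^2,\frac{a^2}{q},b^2,\frac{b^2}{q};q^2\right)_\infty}{\left(f,\frac{q^2}{f},qf,\frac qf,a^4,a^2b^2,\frac{a^2b^2}{q};q^2\right)_\infty}\int_{-\pi}^{\pi}\frac{\left((q^{\frac12}f,\frac{q^{3/2}}{f})\frac\sigma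 w,\,(q^{\frac12}f,\frac{q^{3/2}}{f},q^{-\frac12}a^4b^2)\frac w\sigma;q^2\right)_\infty}{\left(q^{\pm\frac12}\frac\sigma w,\,(q^{\pm\frac12}a^2,q^{-\frac12}b^2)\frac w\sigma;q^2\right)_\infty}\;{}_3\phi_2\!\left({a^4,a^2b^2,q^{\frac12}b^2\frac\sigma w\atop qa^2b^2,q^{-\frac12}a^4b^2\frac w\sigma};q^2,q^{\frac12}z\frac w\sigma\right)d\psi.$$ -/

import Mathlib

open Real Filter Topology MeasureTheory

noncomputable section

/-- The finite `q`-shifted factorial `(a;q)_n = (1-a)(1-aq)⋯(1-aq^{n-1})`. -/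
def qPoch (a q : ℂ) (n : ℕ) : ℂ := ∏ k ∈ Finset.range n, (1 - a * q ^ k)

/-- The infinite `q`-shifted factorial `(a;q)_∞` (used for `|q| < 1`). -/
def qPochInf (a q : ℂ) : ℂ := ∏' k : ℕ, (1 - a * q ^ k)

/-- For `|q| < 1`, `(a;q)_∞` is the limit of `(a;q)_n`. -/
theorem tendsto_qPoch (a q : ℂ) (hq : ‖q‖ < 1) :
    Tendsto (qPoch a q) atTop (𝓝 (qPochInf a q)) := by
  have hs : Summable (fun k : ℕ => ‖-(a * q ^ k)‖) := by
    simp only [norm_neg, norm_mul, norm_pow]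
    exact (summable_geometric_of_lt_one (norm_nonneg q) hq).mul_left _
  have hm := (multipliable_one_add_of_summable hs).tendsto_prod_tprod_nat
  simp only [← sub_eq_add_neg] at hm
  exact hm

/-- The product convention `(a₁,…,a_k;q)_n = (a₁;q)_n ⋯ (a_k;q)_n`. -/
def qPochList (A : List ℂ) (q : ℂ) (n : ℕ) : ℂ := (A.map fun a => qPoch a q n).prod

/-- The product convention `(a₁,…,a_k;q)_∞ = (a₁;q)_∞ ⋯ (a_k;q)_∞`. -/
def qPochInfList (A : List ℂ) (q : ℂ) : ℂ := (A.map fun a => qPochInf a q).prod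

/-- The set `Ω_q = {q^{-k} : k = 0, 1, 2, …}` of forbidden lower parameters. -/
def qOmega (q : ℂ) : Set ℂ := {x | ∃ k : ℕ, x = (q ^ k)⁻¹}

/-- The `k`-th term of the basic hypergeometric series `r φ s (A; B; q, z)`, where
`r` and `s` are the lengths of the lists `A` and `B`. -/
def qHypTerm (A B : List ℂ) (q z : ℂ) (k : ℕ) : ℂ :=
  qPochList A q k / qPochList (q :: B) q k
    * ((-1) ^ k * q ^ (k.choose 2)) ^ (1 + (B.length : ℤ) - (A.length : ℤ)) * z ^ k

/-- The basic hypergeometric series `r φ s (A; B; q, z)`. -/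
def qHyp (A B : List ℂ) (q z : ℂ) : ℂ := ∑' k : ℕ, qHypTerm A B q z k

/-- Numerator parameters of the `₃φ₂` in the integrand, where `h = q^{1/2}`, and `u = σ/w`. -/
def upper32 (h a b u : ℂ) : List ℂ := [a ^ 4, a ^ 2 * b ^ 2, h * b ^ 2 * u]

/-- Denominator parameters of the `₃φ₂` in the integrand, where `h = q^{1/2}`, and `v = w/σ`. -/
def lower32 (q h a b v : ℂ) : List ℂ := [q * a ^ 2 * b ^ 2, h⁻¹ * a ^ 4 * b ^ 2 * v]

/-- The integrand at `w = e^{iψ}`; here `h` stands for `q^{1/2}`. -/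
def prodIntegrand (q h a b z f : ℂ) (σ ψ : ℝ) : ℂ :=
  let w : ℂ := Complex.exp (Complex.I * (ψ : ℂ))
  let u : ℂ := (σ : ℂ) / w
  let v : ℂ := w / (σ : ℂ)
  qPochInfList [h * f * u, h ^ 3 / f * u, h * f * v, h ^ 3 / f * v,
      h⁻¹ * a ^ 4 * b ^ 2 * v] (q ^ 2)
    / qPochInfList [h * u, h⁻¹ * u, h * a ^ 2 * v, h⁻¹ * a ^ 2 * v, h⁻¹ * b ^ 2 * v] (q ^ 2)
    * qHyp (upper32 h a b u) (lower32 q h a b v) (q ^ 2) (h * z * v)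

/-- The factor in front of the integral. -/
def prodPrefactor (q a b f : ℂ) : ℂ :=
  1 / (2 * (π : ℂ)) *
    (qPochInfList [q ^ 2, q * a ^ 2, a ^ 2, a ^ 2, a ^ 2 / q, b ^ 2, b ^ 2 / q] (q ^ 2)
      / qPochInfList [f, q ^ 2 / f, q * f, q / f, a ^ 4, a ^ 2 * b ^ 2, a ^ 2 * b ^ 2 / q]
          (q ^ 2))

end

/-! ### Basic properties of the `q`-shifted factorials -/

theorem qPoch_zero (a q : ℂ) : qPoch a q 0 = 1 := by simp [qPoch]

theorem qPoch_succ (a q : ℂ) (n : ℕ) : qPoch a q (n + 1) = qPoch a q n * (1 - a * q ^ n) := by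
  simp [qPoch, Finset.prod_range_succ]

theorem qPoch_succ' (a q : ℂ) (n : ℕ) :
    qPoch a q (n + 1) = (1 - a) * qPoch (a * q) q n := by
  simp only [qPoch, Finset.prod_range_succ', pow_zero, mul_one]
  rw [mul_comm]
  congr 1
  exact Finset.prod_congr rfl fun k _ => by ring

theorem summable_norm_mul_pow (a : ℂ) {q : ℂ} (hq : ‖q‖ < 1) :
    Summable fun k : ℕ => ‖-(a * q ^ k)‖ := by
  simp only [norm_neg, norm_mul, norm_pow]
  exact (summable_geometric_of_lt_one (norm_nonneg q) hq).mul_left _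

theorem qPochInf_zero (q : ℂ) : qPochInf 0 q = 1 := by simp [qPochInf]

theorem qPoch_mul_qPochInf (a : ℂ) {q : ℂ} (hq : ‖q‖ < 1) (n : ℕ) :
    qPoch a q n * qPochInf (a * q ^ n) q = qPochInf a q := by
  have h1 : Tendsto (fun m => qPoch a q (m + n)) atTop (𝓝 (qPochInf a q)) :=
    (tendsto_add_atTop_iff_nat n).2 (tendsto_qPoch a q hq)
  have h2 := (tendsto_qPoch (a * q ^ n) q hq).const_mul (qPoch a q n)
  refine tendsto_nhds_unique h2 (h1.congr fun m => ?_)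
  simp only [qPoch]
  rw [add_comm m n, Finset.prod_range_add]
  congr 1
  exact Finset.prod_congr rfl fun k _ => by ring

theorem qPochInf_eq_one_sub_mul (a : ℂ) {q : ℂ} (hq : ‖q‖ < 1) :
    qPochInf a q = (1 - a) * qPochInf (a * q) q := by
  have := qPoch_mul_qPochInf a hq 1
  rw [qPoch_succ, qPoch_zero] at this
  simpa using this.symm

theorem qPochInf_ne_zero {a q : ℂ} (hq : ‖q‖ < 1) (h : ∀ k : ℕ, a * q ^ k ≠ 1) :
    qPochInf a q ≠ 0 := by
  have := tprod_one_add_ne_zero_of_summable (f := fun k : ℕ => -(a * q ^ k))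
    (fun k => by
      rw [← sub_eq_add_neg, sub_ne_zero]
      exact (h k).symm) (summable_norm_mul_pow a hq)
  simp only [← sub_eq_add_neg] at this
  exact this

theorem mul_pow_ne_one {a q : ℂ} (hq : ‖q‖ < 1) (ha : ‖a‖ < 1) (k : ℕ) : a * q ^ k ≠ 1 := by
  intro h
  have h1 : ‖a * q ^ k‖ < 1 := by
    rw [norm_mul, norm_pow]
    calc ‖a‖ * ‖q‖ ^ k ≤ ‖a‖ * 1 := by
          gcongr
          exact pow_le_one₀ (norm_nonneg _) hq.le
      _ < 1 := by simpa using ha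
  rw [h] at h1
  simp at h1

theorem qPochInf_ne_zero_of_norm_lt_one {a q : ℂ} (hq : ‖q‖ < 1) (ha : ‖a‖ < 1) :
    qPochInf a q ≠ 0 :=
  qPochInf_ne_zero hq (mul_pow_ne_one hq ha)

theorem qPoch_ne_zero {a q : ℂ} {n : ℕ} (h : ∀ k : ℕ, k < n → a * q ^ k ≠ 1) :
    qPoch a q n ≠ 0 := by
  rw [qPoch, Finset.prod_ne_zero_iff]
  intro k hk
  rw [sub_ne_zero]
  exact (h k (Finset.mem_range.1 hk)).symm

theorem qPoch_ne_zero_of_norm_lt_one {a q : ℂ} (hq : ‖q‖ < 1) (ha : ‖a‖ < 1) (n : ℕ) :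
    qPoch a q n ≠ 0 :=
  qPoch_ne_zero fun k _ => mul_pow_ne_one hq ha k

theorem differentiable_qPochInf {q : ℂ} (hq : ‖q‖ < 1) :
    Differentiable ℂ fun a => qPochInf a q := by
  intro a
  have hu : Summable fun k : ℕ => (‖a‖ + 1) * ‖q‖ ^ k :=
    (summable_geometric_of_lt_one (norm_nonneg q) hq).mul_left _
  have h := hu.hasProdLocallyUniformlyOn_nat_one_add (f := fun (k : ℕ) (b : ℂ) => -(b * q ^ k))
    (K := Metric.ball (0 : ℂ) (‖a‖ + 1)) Metric.isOpen_ball (.of_forall fun k x hx => by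
      rw [norm_neg, norm_mul, norm_pow]
      gcongr
      simpa using (mem_ball_zero_iff.1 hx).le) (fun _ => by fun_prop)
  have hd := h.differentiableOn (.of_forall fun s => by
    simpa [Finset.prod_fn] using DifferentiableOn.finsetProd (fun _ _ => by fun_prop))
    Metric.isOpen_ball
  have h2 := hd.differentiableAt (x := a) (Metric.isOpen_ball.mem_nhds (by simp))
  simp only [← sub_eq_add_neg] at h2
  exact h2

theorem continuous_qPochInf {q : ℂ} (hq : ‖q‖ < 1) : Continuous fun a => qPochInf a q :=
  (differentiable_qPochInf hq).continuous

theorem norm_qPoch_le {a q : ℂ} {R : ℝ} (hq : ‖q‖ < 1) (ha : ‖a‖ ≤ R) (n : ℕ) :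
    ‖qPoch a q n‖ ≤ Real.exp (R / (1 - ‖q‖)) := by
  have hR : 0 ≤ R := (norm_nonneg a).trans ha
  have hs := summable_geometric_of_lt_one (norm_nonneg q) hq
  calc ‖qPoch a q n‖ ≤ ∏ k ∈ Finset.range n, Real.exp (R * ‖q‖ ^ k) := by
        rw [qPoch, norm_prod]
        refine Finset.prod_le_prod (fun _ _ => norm_nonneg _) fun k _ => ?_
        calc ‖1 - a * q ^ k‖ ≤ ‖(1 : ℂ)‖ + ‖a * q ^ k‖ := norm_sub_le _ _
          _ = 1 + ‖a‖ * ‖q‖ ^ k := by simp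
          _ ≤ R * ‖q‖ ^ k + 1 := by rw [add_comm]; gcongr
          _ ≤ _ := Real.add_one_le_exp _
    _ = Real.exp (∑ k ∈ Finset.range n, R * ‖q‖ ^ k) := (Real.exp_sum _ _).symm
    _ ≤ Real.exp (R / (1 - ‖q‖)) := by
        rw [← Finset.mul_sum, div_eq_mul_inv, ← tsum_geometric_of_lt_one (norm_nonneg q) hq]
        gcongr
        exact hs.sum_le_tsum _ fun _ _ => by positivity

theorem norm_qPochInf_le {a q : ℂ} {R : ℝ} (hq : ‖q‖ < 1) (ha : ‖a‖ ≤ R) :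
    ‖qPochInf a q‖ ≤ Real.exp (R / (1 - ‖q‖)) :=
  le_of_tendsto (tendsto_qPoch a q hq).norm (.of_forall fun n => norm_qPoch_le hq ha n)

/-- The reciprocals of `(a;q)_n` are bounded in `n`, with the convention `1 / 0 = 0`. -/
theorem exists_norm_inv_qPoch_le (a : ℂ) {q : ℂ} (hq : ‖q‖ < 1) :
    ∃ M : ℝ, ∀ n, ‖(qPoch a q n)⁻¹‖ ≤ M := by
  by_cases h : ∀ k : ℕ, a * q ^ k ≠ 1
  · have ht := ((tendsto_qPoch a q hq).inv₀ (qPochInf_ne_zero hq h)).norm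
    obtain ⟨M, hM⟩ := ht.bddAbove_range
    exact ⟨M, fun n => hM ⟨n, rfl⟩⟩
  · push Not at h
    obtain ⟨k, hk⟩ := h
    have hz : ∀ n, k < n → qPoch a q n = 0 := fun n hn =>
      Finset.prod_eq_zero (Finset.mem_range.2 hn) (by rw [hk, sub_self])
    refine ⟨∑ n ∈ Finset.range (k + 1), ‖(qPoch a q n)⁻¹‖, fun n => ?_⟩
    by_cases hn : n < k + 1
    · exact Finset.single_le_sum (f := fun n => ‖(qPoch a q n)⁻¹‖) (fun _ _ => norm_nonneg _)
        (Finset.mem_range.2 hn)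
    · rw [hz n (by omega), inv_zero, norm_zero]
      exact Finset.sum_nonneg fun _ _ => norm_nonneg _

theorem exists_norm_qPochList_le (A : List ℂ) {q : ℂ} (hq : ‖q‖ < 1) :
    ∃ M : ℝ, ∀ n, ‖qPochList A q n‖ ≤ M := by
  induction A with
  | nil => exact ⟨1, fun n => by simp [qPochList]⟩
  | cons a A ih =>
    obtain ⟨M, hM⟩ := ih
    refine ⟨Real.exp (‖a‖ / (1 - ‖q‖)) * M, fun n => ?_⟩
    have := hM n
    simp only [qPochList, List.map_cons, List.prod_cons, norm_mul] at this ⊢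
    gcongr
    exact norm_qPoch_le hq le_rfl n

theorem exists_norm_inv_qPochList_le (A : List ℂ) {q : ℂ} (hq : ‖q‖ < 1) :
    ∃ M : ℝ, ∀ n, ‖(qPochList A q n)⁻¹‖ ≤ M := by
  induction A with
  | nil => exact ⟨1, fun n => by simp [qPochList]⟩
  | cons a A ih =>
    obtain ⟨M, hM⟩ := ih
    obtain ⟨M', hM'⟩ := exists_norm_inv_qPoch_le a hq
    refine ⟨M' * M, fun n => ?_⟩
    have h1 := hM n
    have h2 := hM' n
    simp only [qPochList, List.map_cons, List.prod_cons, mul_inv, norm_mul] at h1 ⊢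
    have := (norm_nonneg _).trans h2
    gcongr

/-! ### Absolute convergence of balanced-length series -/

theorem qHypTerm_balanced {A B : List ℂ} (hAB : A.length = B.length + 1) (q z : ℂ) (k : ℕ) :
    qHypTerm A B q z k = qPochList A q k / qPochList (q :: B) q k * z ^ k := by
  have : 1 + (B.length : ℤ) - (A.length : ℤ) = 0 := by rw [hAB]; push_cast; ring
  rw [qHypTerm, this, zpow_zero, mul_one]

theorem summable_norm_qHypTerm {A B : List ℂ} (hAB : A.length = B.length + 1) {q z : ℂ}
    (hq : ‖q‖ < 1) (hz : ‖z‖ < 1) : Summable fun k => ‖qHypTerm A B q z k‖ := by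
  obtain ⟨M, hM⟩ := exists_norm_qPochList_le A hq
  obtain ⟨M', hM'⟩ := exists_norm_inv_qPochList_le (q :: B) hq
  refine Summable.of_nonneg_of_le (fun _ => norm_nonneg _) (fun k => ?_)
    ((summable_geometric_of_lt_one (norm_nonneg z) hz).mul_left (M * M'))
  rw [qHypTerm_balanced hAB, div_eq_mul_inv, norm_mul, norm_mul, norm_pow]
  have h1 := hM k
  have h2 := hM' k
  have := (norm_nonneg _).trans h1
  gcongr

/-! ### Circle averages and `q`-difference equations -/

/-- Multiplication by `Q` rotates the circle and shrinks its radius to `|Q|r`. The rotation does not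
affect an average, and Cauchy's theorem on the annulus moves the radius back to `r`. -/
theorem circleAverage_comp_mul_left {G : ℂ → ℂ} {Q : ℂ} {r : ℝ} (hr : 0 < r) (hQ0 : Q ≠ 0)
    (hQ1 : ‖Q‖ < 1) (hG : ∀ v, ‖Q‖ * r ≤ ‖v‖ → ‖v‖ ≤ r → DifferentiableAt ℂ G v) :
    circleAverage (fun v => G (Q * v)) 0 r = circleAverage G 0 r := by
  have hQn : 0 < ‖Q‖ := norm_pos_iff.2 hQ0
  have h1 : circleAverage (fun v => G (Q * v)) 0 r = circleAverage G 0 (‖Q‖ * r) := by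
    rw [circleAverage_eq_integral_add (f := G) (R := ‖Q‖ * r) Q.arg, circleAverage_def]
    congr 1
    refine intervalIntegral.integral_congr fun θ _ => ?_
    simp only [circleMap_zero]
    congr 1
    conv_lhs => rw [← Complex.norm_mul_exp_arg_mul_I Q]
    push_cast
    rw [add_mul, Complex.exp_add]
    ring
  have hle : ‖Q‖ * r ≤ r := by nlinarith
  rw [h1, circleAverage_eq_circleIntegral (by positivity), circleAverage_eq_circleIntegral hr.ne']
  congr 1
  refine (Complex.circleIntegral_sub_center_inv_smul_eq_of_differentiable_on_annulus_off_countable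
    (by positivity) hle Set.countable_empty ?_ ?_).symm
  · intro v hv
    refine (hG v ?_ ?_).continuousAt.continuousWithinAt
    · simpa using hv.2
    · simpa using hv.1
  · intro v hv
    refine hG v ?_ ?_
    · simpa using (not_le.1 fun h => hv.1.2 (mem_closedBall_zero_iff.2 h)).le
    · simpa using (mem_ball_zero_iff.1 hv.1.1).le

/-- The average over the circle `|v| = r` of `Ψ(v) / ((v - C)(v - D))`. -/
noncomputable def poleAverage (C D : ℂ) (r : ℝ) (Ψ : ℂ → ℂ) : ℂ :=
  circleAverage (fun v => Ψ v / ((v - C) * (v - D))) 0 r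

/-- The function `Ψ` is holomorphic on the annulus `|Q|r ≤ |v| ≤ r` and `Ψ(v) / ((v - C)(v - D))`
satisfies on its outer boundary the first order `Q`-difference equation with parameters
`A, B, F`. -/
structure IsQWeight (Q C D A B F : ℂ) (r : ℝ) (Ψ : ℂ → ℂ) : Prop where
  differentiableAt : ∀ v, ‖Q‖ * r ≤ ‖v‖ → ‖v‖ ≤ r → DifferentiableAt ℂ Ψ v
  eq : ∀ v, ‖v‖ = r → Ψ (Q * v) * ((v - C) * (v - D)) =
    C * D * Q * ((1 - A * v) * (1 - B * v) * (1 - F * v)) * Ψ v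

section

variable {Q C D A B F : ℂ} {r : ℝ} {Ψ : ℂ → ℂ}

theorem sub_ne_zero_of_norm {v C : ℂ} (hC : ‖C‖ < r) (hv : ‖v‖ = r) : v - C ≠ 0 := by
  intro h
  rw [sub_eq_zero.1 h] at hv
  linarith

theorem continuous_pole_circleMap (hr : 0 < r) (hQ1 : ‖Q‖ < 1) (hC : ‖C‖ < r) (hD : ‖D‖ < r)
    (hΨ : ∀ v, ‖Q‖ * r ≤ ‖v‖ → ‖v‖ ≤ r → DifferentiableAt ℂ Ψ v) :
    Continuous fun θ : ℝ => Ψ (circleMap 0 r θ) /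
      ((circleMap 0 r θ - C) * (circleMap 0 r θ - D)) := by
  have hn : ∀ θ, ‖circleMap 0 r θ‖ = r := fun θ => by simp [abs_of_pos hr]
  have hle : ‖Q‖ * r ≤ r := by nlinarith [norm_nonneg Q]
  have h1 : Continuous fun θ : ℝ => Ψ (circleMap 0 r θ) := by
    rw [continuous_iff_continuousAt]
    intro θ
    exact ContinuousAt.comp (g := Ψ)
      (hΨ _ (by rw [hn]; exact hle) (hn θ).le).continuousAt (continuous_circleMap 0 r).continuousAt
  refine h1.div (by fun_prop) fun θ => ?_
  exact mul_ne_zero (sub_ne_zero_of_norm hC (hn θ)) (sub_ne_zero_of_norm hD (hn θ))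

theorem circleIntegrable_pole (hr : 0 < r) (hQ1 : ‖Q‖ < 1) (hC : ‖C‖ < r) (hD : ‖D‖ < r)
    (hΨ : ∀ v, ‖Q‖ * r ≤ ‖v‖ → ‖v‖ ≤ r → DifferentiableAt ℂ Ψ v) :
    CircleIntegrable (fun v => Ψ v / ((v - C) * (v - D))) 0 r :=
  (continuous_pole_circleMap hr hQ1 hC hD hΨ).intervalIntegrable _ _

theorem circleAverage_const_mul (c : ℂ) (f : ℂ → ℂ) :
    circleAverage (fun v => c * f v) 0 r = c * circleAverage f 0 r := by
  simpa [smul_eq_mul] using circleAverage_fun_smul (a := c) (f := f) (c := 0) (R := r)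

theorem _root_.CircleIntegrable.const_mul {f : ℂ → ℂ} (hf : CircleIntegrable f 0 r) (c : ℂ) :
    CircleIntegrable (fun v => c * f v) 0 r :=
  hf.const_fun_smul (a := c)

theorem poleAverage_congr {Ψ' : ℂ → ℂ} (hr : 0 < r) (h : ∀ v, ‖v‖ = r → Ψ v = Ψ' v) :
    poleAverage C D r Ψ = poleAverage C D r Ψ' := by
  refine circleAverage_congr_sphere fun v hv => ?_
  rw [mem_sphere_zero_iff_norm, abs_of_pos hr] at hv
  simp only [h v hv]

/-- The average of `G(Qv) - G(v)` vanishes for `G(v) = Ψ(v)(Xv;Q)_∞/v`, `X = ABCDF`. After the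
difference equation this is the claim, by the polynomial identity `(1-AC)(1-AD)(1-Xv) -
(1-ABCD)(1-ACDF)(1-Av) = -A[CD(1-Av)(1-Bv)(1-Fv) - (1-Xv)(v-C)(v-D)]/v`. The poles `C`, `D`, which
may lie in the annulus, do not enter `G`; they are divided out only on `|v| = r`. The net effect is
to replace `A` by `AQ`. -/
theorem IsQWeight.step (hr : 0 < r) (hQ0 : Q ≠ 0) (hQ1 : ‖Q‖ < 1) (hC : ‖C‖ < r) (hD : ‖D‖ < r)
    (h : IsQWeight Q C D A B F r Ψ) :
    (1 - A * C) * (1 - A * D) *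
        poleAverage C D r (fun v => Ψ v * qPochInf (A * B * C * D * F * v) Q) =
      (1 - A * B * C * D) * (1 - A * C * D * F) * poleAverage C D r
        (fun v => Ψ v * (1 - A * v) * qPochInf (A * Q * B * C * D * F * v) Q) := by
  set X := A * B * C * D * F with hX
  have hdP : Differentiable ℂ fun v => qPochInf (X * v) Q :=
    (differentiable_qPochInf hQ1).comp (differentiable_id.const_mul X)
  have hdP' : Differentiable ℂ fun v => qPochInf (A * Q * B * C * D * F * v) Q :=
    (differentiable_qPochInf hQ1).comp (differentiable_id.const_mul _)
  have hQn : 0 < ‖Q‖ := norm_pos_iff.2 hQ0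
  set G : ℂ → ℂ := fun v => Ψ v * qPochInf (X * v) Q / v with hGdef
  have hGd : ∀ v, ‖Q‖ * r ≤ ‖v‖ → ‖v‖ ≤ r → DifferentiableAt ℂ G v := fun v h1 h2 => by
    have hv : v ≠ 0 := norm_pos_iff.1 (lt_of_lt_of_le (by positivity) h1)
    exact ((h.differentiableAt v h1 h2).mul (hdP v)).div differentiableAt_id hv
  have hG := circleAverage_comp_mul_left hr hQ0 hQ1 hGd
  have hle : ‖Q‖ * r ≤ r := by nlinarith
  have hQG : CircleIntegrable (fun v => G (Q * v)) 0 r := by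
    refine Continuous.intervalIntegrable ?_ _ _
    rw [continuous_iff_continuousAt]
    intro θ
    refine ContinuousAt.comp (g := G) (hGd _ ?_ ?_).continuousAt (by fun_prop) <;>
      simp [abs_of_pos hr, hle]
  have hGi : CircleIntegrable G 0 r := by
    refine Continuous.intervalIntegrable ?_ _ _
    rw [continuous_iff_continuousAt]
    intro θ
    refine ContinuousAt.comp (g := G) (hGd _ ?_ ?_).continuousAt (by fun_prop) <;>
      simp [abs_of_pos hr, hle]
  have h0 := circleIntegrable_pole hr hQ1 hC hD
    (Ψ := fun v => Ψ v * qPochInf (X * v) Q) fun v h1 h2 =>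
      (h.differentiableAt v h1 h2).mul (hdP v)
  have h1 := circleIntegrable_pole hr hQ1 hC hD
    (Ψ := fun v => Ψ v * (1 - A * v) * qPochInf (A * Q * B * C * D * F * v) Q) fun v h1 h2 =>
      ((h.differentiableAt v h1 h2).mul (by fun_prop)).mul (hdP' v)
  rw [← sub_eq_zero, poleAverage, poleAverage, ← circleAverage_const_mul, ← circleAverage_const_mul,
    ← circleAverage_fun_sub (h0.const_mul _) (h1.const_mul _)]
  have hsub : circleAverage (fun v => -A * (G (Q * v) - G v)) 0 r = 0 := by
    rw [circleAverage_const_mul, circleAverage_fun_sub hQG hGi, hG, sub_self, mul_zero]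
  refine Eq.trans (circleAverage_congr_sphere fun v hv => ?_) hsub
  rw [mem_sphere_zero_iff_norm, abs_of_pos hr] at hv
  have hv0 : v ≠ 0 := norm_pos_iff.1 (by rw [hv]; exact hr)
  have hvC := sub_ne_zero_of_norm hC hv
  have hvD := sub_ne_zero_of_norm hD hv
  have he : Ψ (Q * v) = C * D * Q * ((1 - A * v) * (1 - B * v) * (1 - F * v)) * Ψ v /
      ((v - C) * (v - D)) := by
    rw [eq_div_iff (mul_ne_zero hvC hvD), h.eq v hv]
  have e1 : A * Q * B * C * D * F * v = X * v * Q := by rw [hX]; ring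
  have e2 : X * (Q * v) = X * v * Q := by ring
  simp only [hGdef, he, e1, e2]
  rw [qPochInf_eq_one_sub_mul (X * v) hQ1, hX]
  field_simp
  ring

/-- The quotient of `(AQv;Q)_n` by `(Av;Q)_n` telescopes to `(1-AQ^n v)/(1-Av)`, so `A` becomes
`AQ^n`. With the infinite product, below, it becomes `0`. -/
theorem IsQWeight.mul_qPoch (h : IsQWeight Q C D A B F r Ψ) (n : ℕ) :
    IsQWeight Q C D (A * Q ^ n) B F r (fun v => Ψ v * qPoch (A * v) Q n) := by
  refine ⟨fun v h1 h2 => (h.differentiableAt v h1 h2).mul ?_, fun v hv => ?_⟩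
  · simp only [qPoch]
    fun_prop
  · have e : qPoch (A * (Q * v)) Q n * (1 - A * v) = qPoch (A * v) Q n * (1 - A * Q ^ n * v) := by
      rw [show A * (Q * v) = A * v * Q by ring, mul_comm, ← qPoch_succ', qPoch_succ]
      ring
    calc Ψ (Q * v) * qPoch (A * (Q * v)) Q n * ((v - C) * (v - D))
        = (Ψ (Q * v) * ((v - C) * (v - D))) * qPoch (A * (Q * v)) Q n := by ring
      _ = C * D * Q * ((1 - B * v) * (1 - F * v)) * Ψ v *
          (qPoch (A * (Q * v)) Q n * (1 - A * v)) := by rw [h.eq v hv]; ring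
      _ = _ := by rw [e]; ring

theorem IsQWeight.mul_qPochInf (hQ1 : ‖Q‖ < 1) (h : IsQWeight Q C D A B F r Ψ) :
    IsQWeight Q C D 0 B F r (fun v => Ψ v * qPochInf (A * v) Q) := by
  refine ⟨fun v h1 h2 => (h.differentiableAt v h1 h2).mul ?_, fun v hv => ?_⟩
  · exact (differentiable_qPochInf hQ1).comp (differentiable_id.const_mul A) v
  · have e : qPochInf (A * v) Q = (1 - A * v) * qPochInf (A * (Q * v)) Q := by
      rw [show A * (Q * v) = A * v * Q by ring, ← qPochInf_eq_one_sub_mul _ hQ1]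
    rw [e]
    linear_combination qPochInf (A * (Q * v)) Q * h.eq v hv

/-- A cyclic rotation of the three parameters, so that a result about the first slot applies to each
in turn. -/
theorem IsQWeight.symm (h : IsQWeight Q C D A B F r Ψ) : IsQWeight Q C D B F A r Ψ :=
  ⟨h.differentiableAt, fun v hv => by rw [h.eq v hv]; ring⟩

theorem IsQWeight.iterate (hr : 0 < r) (hQ0 : Q ≠ 0) (hQ1 : ‖Q‖ < 1) (hC : ‖C‖ < r)
    (hD : ‖D‖ < r) (h : IsQWeight Q C D A B F r Ψ) (n : ℕ) :
    qPoch (A * C) Q n * qPoch (A * D) Q n *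
        poleAverage C D r (fun v => Ψ v * qPochInf (A * B * C * D * F * v) Q) =
      qPoch (A * B * C * D) Q n * qPoch (A * C * D * F) Q n * poleAverage C D r
        (fun v => Ψ v * (qPoch (A * v) Q n * qPochInf (A * B * C * D * F * v * Q ^ n) Q)) := by
  induction n with
  | zero => simp [qPoch_zero]
  | succ n ih =>
    have hs := (h.mul_qPoch n).step hr hQ0 hQ1 hC hD
    have e1 : (fun v => Ψ v * qPoch (A * v) Q n * qPochInf (A * Q ^ n * B * C * D * F * v) Q) =
        fun v => Ψ v * (qPoch (A * v) Q n * qPochInf (A * B * C * D * F * v * Q ^ n) Q) := by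
      funext v
      rw [show A * Q ^ n * B * C * D * F * v = A * B * C * D * F * v * Q ^ n by ring]
      ring
    have e2 : (fun v => Ψ v * qPoch (A * v) Q n * (1 - A * Q ^ n * v) *
          qPochInf (A * Q ^ n * Q * B * C * D * F * v) Q) =
        fun v => Ψ v * (qPoch (A * v) Q (n + 1) *
          qPochInf (A * B * C * D * F * v * Q ^ (n + 1)) Q) := by
      funext v
      rw [show A * Q ^ n * Q * B * C * D * F * v = A * B * C * D * F * v * Q ^ (n + 1) by ring,
        qPoch_succ]
      ring
    rw [e1, e2] at hs
    simp only [qPoch_succ (A * C), qPoch_succ (A * D), qPoch_succ (A * B * C * D),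
      qPoch_succ (A * C * D * F)]
    linear_combination (1 - A * C * Q ^ n) * (1 - A * D * Q ^ n) * ih +
      qPoch (A * B * C * D) Q n * qPoch (A * C * D * F) Q n * hs

theorem tendsto_poleAverage (hr : 0 < r) (hQ1 : ‖Q‖ < 1) (hC : ‖C‖ < r) (hD : ‖D‖ < r)
    (hΨ : ∀ v, ‖Q‖ * r ≤ ‖v‖ → ‖v‖ ≤ r → DifferentiableAt ℂ Ψ v) {g : ℕ → ℂ → ℂ} {g' : ℂ → ℂ}
    (hg : ∀ n, Continuous (g n)) {M : ℝ} (hM : ∀ n v, ‖v‖ = r → ‖g n v‖ ≤ M)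
    (hlim : ∀ v, Tendsto (fun n => g n v) atTop (𝓝 (g' v))) :
    Tendsto (fun n => poleAverage C D r fun v => Ψ v * g n v) atTop
      (𝓝 (poleAverage C D r fun v => Ψ v * g' v)) := by
  have hc := continuous_pole_circleMap hr hQ1 hC hD hΨ
  simp only [poleAverage, circleAverage_def]
  refine Tendsto.const_smul ?_ _
  have e : ∀ (f : ℂ → ℂ) (θ : ℝ), Ψ (circleMap 0 r θ) * f (circleMap 0 r θ) /
      ((circleMap 0 r θ - C) * (circleMap 0 r θ - D)) = Ψ (circleMap 0 r θ) /
      ((circleMap 0 r θ - C) * (circleMap 0 r θ - D)) * f (circleMap 0 r θ) := fun f θ => by ring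
  simp only [e]
  refine intervalIntegral.tendsto_integral_filter_of_dominated_convergence
    (fun θ => ‖Ψ (circleMap 0 r θ) / ((circleMap 0 r θ - C) * (circleMap 0 r θ - D))‖ * M)
    (.of_forall fun n => ?_) (.of_forall fun n => .of_forall fun θ _ => ?_)
    ((hc.norm.mul continuous_const).intervalIntegrable _ _) (.of_forall fun θ _ => ?_)
  · exact (hc.mul ((hg n).comp (continuous_circleMap 0 r))).aestronglyMeasurable
  · rw [norm_mul]
    gcongr
    exact hM n _ (by simp [abs_of_pos hr])
  · exact (hlim _).const_mul _

/-- The limit `n → ∞` of `IsQWeight.iterate`: the tail `(ABCDFvQ^n;Q)_∞` tends to `1` and `(Av;Q)_n`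
to `(Av;Q)_∞`, boundedly on the circle. -/
theorem IsQWeight.eliminate (hr : 0 < r) (hQ0 : Q ≠ 0) (hQ1 : ‖Q‖ < 1) (hC : ‖C‖ < r)
    (hD : ‖D‖ < r) (h : IsQWeight Q C D A B F r Ψ) :
    qPochInf (A * C) Q * qPochInf (A * D) Q *
        poleAverage C D r (fun v => Ψ v * qPochInf (A * B * C * D * F * v) Q) =
      qPochInf (A * B * C * D) Q * qPochInf (A * C * D * F) Q * poleAverage C D r
        (fun v => Ψ v * qPochInf (A * v) Q) := by
  have hX := tendsto_poleAverage hr hQ1 hC hD h.differentiableAt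
    (g := fun n v => qPoch (A * v) Q n * qPochInf (A * B * C * D * F * v * Q ^ n) Q)
    (g' := fun v => qPochInf (A * v) Q)
    (M := Real.exp (‖A‖ * r / (1 - ‖Q‖)) * Real.exp (‖A * B * C * D * F‖ * r / (1 - ‖Q‖)))
    (fun n => ?_) (fun n v hv => ?_) (fun v => ?_)
  · refine tendsto_nhds_unique (((tendsto_qPoch (A * C) Q hQ1).mul
      (tendsto_qPoch (A * D) Q hQ1)).mul_const _) ?_
    simp only [h.iterate hr hQ0 hQ1 hC hD]
    exact ((tendsto_qPoch _ Q hQ1).mul (tendsto_qPoch _ Q hQ1)).mul hX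
  · refine Continuous.mul ?_ ((continuous_qPochInf hQ1).comp (by fun_prop))
    simp only [qPoch]
    fun_prop
  · rw [norm_mul]
    gcongr
    · exact norm_qPoch_le hQ1 (by rw [norm_mul, hv]) n
    · refine norm_qPochInf_le hQ1 ?_
      rw [norm_mul, norm_mul, norm_pow, hv]
      exact mul_le_of_le_one_right (by positivity) (pow_le_one₀ (norm_nonneg _) hQ1.le)
  · have h1 : Tendsto (fun n : ℕ => A * B * C * D * F * v * Q ^ n) atTop (𝓝 0) := by
      simpa using (tendsto_pow_atTop_nhds_zero_of_norm_lt_one hQ1).const_mul _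
    have h2 := ((continuous_qPochInf hQ1).tendsto 0).comp h1
    rw [qPochInf_zero] at h2
    simpa using (tendsto_qPoch (A * v) Q hQ1).mul h2

/-- Elimination of all three parameters from the average of a `Q`-weight. -/
theorem IsQWeight.eliminate_all (hr : 0 < r) (hQ0 : Q ≠ 0) (hQ1 : ‖Q‖ < 1) (hC : ‖C‖ < r)
    (hD : ‖D‖ < r) (h : IsQWeight Q C D A B F r Ψ) :
    qPochInf (A * C) Q * qPochInf (A * D) Q * (qPochInf (B * C) Q * qPochInf (B * D) Q) *
        (qPochInf (F * C) Q * qPochInf (F * D) Q) *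
        poleAverage C D r (fun v => Ψ v * qPochInf (A * B * C * D * F * v) Q) =
      qPochInf (A * B * C * D) Q * qPochInf (A * C * D * F) Q * qPochInf (B * C * D * F) Q *
        poleAverage C D r
          (fun v => Ψ v * qPochInf (A * v) Q * qPochInf (B * v) Q * qPochInf (F * v) Q) := by
  have h1 := h.eliminate hr hQ0 hQ1 hC hD
  have w2 := (h.mul_qPochInf hQ1).symm
  have h2 := w2.eliminate hr hQ0 hQ1 hC hD
  have w3 := (w2.mul_qPochInf hQ1).symm
  have h3 := w3.eliminate hr hQ0 hQ1 hC hD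
  -- After the first elimination one slot is `0`, so the product of all parameters is `0` and the
  -- extra infinite product is `1`.
  simp only [mul_zero, zero_mul, qPochInf_zero, mul_one, one_mul] at h2 h3
  rw [mul_right_comm B F C, mul_right_comm (B * C) F D] at h2
  linear_combination (qPochInf (B * C) Q * qPochInf (B * D) Q) *
        (qPochInf (F * C) Q * qPochInf (F * D) Q) * h1 +
      qPochInf (A * B * C * D) Q * qPochInf (A * C * D * F) Q *
        (qPochInf (F * C) Q * qPochInf (F * D) Q) * h2 +
      qPochInf (A * B * C * D) Q * qPochInf (A * C * D * F) Q * qPochInf (B * C * D * F) Q * h3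

end

/-! ### Evaluation of the Askey–Roy type integral -/

section

variable {Q C D A B F ρ ρ' : ℂ} {r : ℝ} {Ψ : ℂ → ℂ}

/-- The product `(ρ/v, ρ'/v, ρv, ρ'v; Q)_∞` of two theta functions when `ρρ' = Q`. -/
noncomputable def thetaPair (Q ρ ρ' v : ℂ) : ℂ :=
  qPochInf (ρ / v) Q * qPochInf (ρ' / v) Q * (qPochInf (ρ * v) Q * qPochInf (ρ' * v) Q)

theorem qPochInf_div_mul_pair (hQ0 : Q ≠ 0) (hQ1 : ‖Q‖ < 1) (hρ : ρ * ρ' = Q) {v : ℂ}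
    (hv : v ≠ 0) : qPochInf (ρ / (Q * v)) Q * qPochInf (ρ' / (Q * v)) Q * (Q * v ^ 2) =
      (1 - ρ * v) * (1 - ρ' * v) * (qPochInf (ρ / v) Q * qPochInf (ρ' / v) Q) := by
  have h1 : ρ ≠ 0 := by rintro rfl; simp at hρ; exact hQ0 hρ.symm
  have h2 : ρ' ≠ 0 := by rintro rfl; simp at hρ; exact hQ0 hρ.symm
  rw [qPochInf_eq_one_sub_mul (ρ / (Q * v)) hQ1, qPochInf_eq_one_sub_mul (ρ' / (Q * v)) hQ1,
    show ρ / (Q * v) * Q = ρ / v by field_simp, show ρ' / (Q * v) * Q = ρ' / v by field_simp,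
    ← hρ]
  field_simp
  ring

/-- Under `v ↦ Qv` the products in `v` lose the factors `1 - ρv`, `1 - ρ'v`. The products in `1/v`
gain factors that, because `ρρ' = Q`, are the same up to `Qv²`. -/
theorem thetaPair_mul_left (hQ0 : Q ≠ 0) (hQ1 : ‖Q‖ < 1) (hρ : ρ * ρ' = Q) {v : ℂ}
    (hv : v ≠ 0) : thetaPair Q ρ ρ' (Q * v) * (Q * v ^ 2) = thetaPair Q ρ ρ' v := by
  have h := qPochInf_div_mul_pair hQ0 hQ1 hρ hv
  have e1 := qPochInf_eq_one_sub_mul (ρ * v) hQ1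
  have e2 := qPochInf_eq_one_sub_mul (ρ' * v) hQ1
  simp only [thetaPair]
  rw [e1, e2, show ρ * v * Q = ρ * (Q * v) by ring, show ρ' * v * Q = ρ' * (Q * v) by ring]
  linear_combination qPochInf (ρ * (Q * v)) Q * qPochInf (ρ' * (Q * v)) Q * h

theorem differentiableAt_qPochInf_div (hQ1 : ‖Q‖ < 1) (a : ℂ) {v : ℂ} (hv : v ≠ 0) :
    DifferentiableAt ℂ (fun v => qPochInf (a / v) Q) v :=
  DifferentiableAt.comp (g := fun x => qPochInf x Q) v (differentiable_qPochInf hQ1 _)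
    ((differentiableAt_const a).div differentiableAt_id hv)

theorem differentiableAt_qPochInf_mul (hQ1 : ‖Q‖ < 1) (a v : ℂ) :
    DifferentiableAt ℂ (fun v => qPochInf (a * v) Q) v :=
  DifferentiableAt.comp (g := fun x => qPochInf x Q) v (differentiable_qPochInf hQ1 _)
    (differentiableAt_id.const_mul a)

theorem differentiableAt_thetaPair (hQ1 : ‖Q‖ < 1) {v : ℂ} (hv : v ≠ 0) :
    DifferentiableAt ℂ (thetaPair Q ρ ρ') v :=
  ((differentiableAt_qPochInf_div hQ1 ρ hv).mul (differentiableAt_qPochInf_div hQ1 ρ' hv)).mul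
    ((differentiableAt_qPochInf_mul hQ1 ρ v).mul (differentiableAt_qPochInf_mul hQ1 ρ' v))

theorem norm_mul_div_lt_one (hr : 0 < r) (hQ0 : Q ≠ 0) (hC : ‖C‖ < r) {v : ℂ}
    (hv : ‖Q‖ * r ≤ ‖v‖) : ‖Q * C / v‖ < 1 := by
  have hQn : 0 < ‖Q‖ := norm_pos_iff.2 hQ0
  have hvn : 0 < ‖v‖ := lt_of_lt_of_le (by positivity) hv
  rw [norm_div, norm_mul, div_lt_one hvn]
  exact lt_of_lt_of_le (by gcongr) hv

theorem norm_div_lt_one (hr : 0 < r) (hC : ‖C‖ < r) {v : ℂ} (hv : ‖v‖ = r) : ‖C / v‖ < 1 := by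
  rwa [norm_div, hv, div_lt_one hr]

theorem norm_mul_lt_one (hA : ‖A‖ * r < 1) {v : ℂ} (hv : ‖v‖ ≤ r) : ‖A * v‖ < 1 := by
  rw [norm_mul]
  exact lt_of_le_of_lt (by gcongr) hA

theorem ne_zero_of_mul_le_norm (hr : 0 < r) (hQ0 : Q ≠ 0) {v : ℂ} (hv : ‖Q‖ * r ≤ ‖v‖) :
    v ≠ 0 := by
  have hQn : 0 < ‖Q‖ := norm_pos_iff.2 hQ0
  exact norm_pos_iff.1 (lt_of_lt_of_le (by positivity) hv)

theorem qPochInf_div_eq (hQ1 : ‖Q‖ < 1) {v : ℂ} (hv : v ≠ 0) :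
    qPochInf (C / v) Q * v = (v - C) * qPochInf (Q * C / v) Q := by
  rw [qPochInf_eq_one_sub_mul (C / v) hQ1, show C / v * Q = Q * C / v by ring]
  field_simp

/-- From `(C/v;Q)_∞ v = (v-C)(QC/v;Q)_∞`: once the first factors are split off as explicit poles,
the remaining denominators do not vanish on the annulus, where `|QC/v| < 1` and `|QD/v| < 1`. -/
theorem isQWeight_of_div (hr : 0 < r) (hQ0 : Q ≠ 0) (hQ1 : ‖Q‖ < 1) (hC : ‖C‖ < r) (hD : ‖D‖ < r)
    {S : ℂ → ℂ} (hS : ∀ v, v ≠ 0 → DifferentiableAt ℂ S v)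
    (hSe : ∀ v, v ≠ 0 → S (Q * v) * (Q * v ^ 2) =
      C * D * ((1 - A * v) * (1 - B * v) * (1 - F * v)) * S v) :
    IsQWeight Q C D A B F r
      (fun v => v ^ 2 * S v / (qPochInf (Q * C / v) Q * qPochInf (Q * D / v) Q)) := by
  refine ⟨fun v h1 h2 => ?_, fun v hv => ?_⟩
  · have hv := ne_zero_of_mul_le_norm hr hQ0 h1
    refine ((differentiableAt_pow 2).mul (hS v hv)).div ?_ ?_
    · exact (differentiableAt_qPochInf_div hQ1 _ hv).mul (differentiableAt_qPochInf_div hQ1 _ hv)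
    · exact mul_ne_zero
        (qPochInf_ne_zero_of_norm_lt_one hQ1 (norm_mul_div_lt_one hr hQ0 hC h1))
        (qPochInf_ne_zero_of_norm_lt_one hQ1 (norm_mul_div_lt_one hr hQ0 hD h1))
  · have hv0 : v ≠ 0 := norm_pos_iff.1 (by rw [hv]; exact hr)
    have hle : ‖Q‖ * r ≤ ‖v‖ := by rw [hv]; nlinarith [norm_nonneg Q]
    have n1 := qPochInf_ne_zero_of_norm_lt_one hQ1 (norm_mul_div_lt_one hr hQ0 hC hle)
    have n2 := qPochInf_ne_zero_of_norm_lt_one hQ1 (norm_mul_div_lt_one hr hQ0 hD hle)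
    have n3 := qPochInf_ne_zero_of_norm_lt_one hQ1 (norm_div_lt_one hr hC hv)
    have n4 := qPochInf_ne_zero_of_norm_lt_one hQ1 (norm_div_lt_one hr hD hv)
    have e1 := qPochInf_div_eq (C := C) hQ1 hv0
    have e2 := qPochInf_div_eq (C := D) hQ1 hv0
    rw [show Q * C / (Q * v) = C / v by field_simp, show Q * D / (Q * v) = D / v by field_simp,
      div_mul_eq_mul_div, ← mul_div_assoc, div_eq_div_iff (mul_ne_zero n3 n4) (mul_ne_zero n1 n2)]
    linear_combination (Q * (v - C) * qPochInf (Q * C / v) Q * ((v - D) * qPochInf (Q * D / v) Q)) *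
      hSe v hv0 - C * D * Q * ((1 - A * v) * (1 - B * v) * (1 - F * v)) * S v *
        (e1 * (qPochInf (D / v) Q * v) + (v - C) * qPochInf (Q * C / v) Q * e2)

theorem poleAverage_div (hr : 0 < r) (hQ1 : ‖Q‖ < 1) (hC : ‖C‖ < r) (hD : ‖D‖ < r)
    (S : ℂ → ℂ) :
    poleAverage C D r (fun v => v ^ 2 * S v / (qPochInf (Q * C / v) Q * qPochInf (Q * D / v) Q)) =
      circleAverage (fun v => S v / (qPochInf (C / v) Q * qPochInf (D / v) Q)) 0 r := by
  refine circleAverage_congr_sphere fun v hv => ?_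
  rw [mem_sphere_zero_iff_norm, abs_of_pos hr] at hv
  have hv0 : v ≠ 0 := norm_pos_iff.1 (by rw [hv]; exact hr)
  have n3 := qPochInf_ne_zero_of_norm_lt_one hQ1 (norm_div_lt_one hr hC hv)
  have n4 := qPochInf_ne_zero_of_norm_lt_one hQ1 (norm_div_lt_one hr hD hv)
  have e1 := qPochInf_div_eq (C := C) hQ1 hv0
  have e2 := qPochInf_div_eq (C := D) hQ1 hv0
  have m1 : (v - C) * qPochInf (Q * C / v) Q ≠ 0 := e1 ▸ mul_ne_zero n3 hv0
  have m2 : (v - D) * qPochInf (Q * D / v) Q ≠ 0 := e2 ▸ mul_ne_zero n4 hv0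
  simp only
  rw [div_div, div_eq_div_iff (mul_ne_zero (mul_ne_zero (right_ne_zero_of_mul m1)
    (right_ne_zero_of_mul m2)) (mul_ne_zero (left_ne_zero_of_mul m1) (left_ne_zero_of_mul m2)))
    (mul_ne_zero n3 n4)]
  linear_combination S v * (e1 * (qPochInf (D / v) Q * v) + (v - C) * qPochInf (Q * C / v) Q * e2)

/-- The average over a circle of a function that is holomorphic outside it, including at
infinity. -/
theorem circleAverage_comp_inv {g : ℂ → ℂ} (hr : 0 < r)
    (hg : ∀ u, ‖u‖ ≤ r⁻¹ → DifferentiableAt ℂ g u) :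
    circleAverage (fun v => g v⁻¹) 0 r = g 0 := by
  have h1 : circleAverage (fun v => g v⁻¹) 0 r = circleAverage g 0 r⁻¹ := by
    rw [circleAverage_eq_circleAverage_zero_one (f := g),
      circleAverage_eq_circleAverage_zero_one (f := fun v => g v⁻¹),
      ← circleAverage_zero_one_congr_inv (f := fun z => g (((r⁻¹ : ℝ) : ℂ) * z + 0))]
    congr 1
    funext z
    simp [mul_comm]
  rw [h1]
  refine circleAverage_of_differentiable_on_off_countable Set.countable_empty
    (fun u hu => (hg u ?_).continuousAt.continuousWithinAt) fun u hu => hg u ?_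
  · simpa [abs_of_pos hr] using hu
  · simpa [abs_of_pos hr] using (mem_ball_zero_iff.1 hu.1).le

/-- Elimination run in the reverse sense: the factors `(ρv, ρ'v;Q)_∞` of the theta functions are
those which elimination of the parameters `ρ`, `ρ'`, `0` produces from a weight in `1/v` alone. -/
theorem circleAverage_thetaPair (hr : 0 < r) (hQ0 : Q ≠ 0) (hQ1 : ‖Q‖ < 1) (hC : ‖C‖ < r)
    (hD : ‖D‖ < r) (hCD : C * D = 1) (hρ : ρ * ρ' = Q) :
    qPochInf Q Q * circleAverage (fun v => thetaPair Q ρ ρ' v /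
        (qPochInf (C / v) Q * qPochInf (D / v) Q)) 0 r =
      qPochInf (ρ * C) Q * qPochInf (ρ * D) Q * (qPochInf (ρ' * C) Q * qPochInf (ρ' * D) Q) := by
  have hw : IsQWeight Q C D ρ ρ' 0 r (fun v => v ^ 2 * (qPochInf (ρ / v) Q * qPochInf (ρ' / v) Q) /
      (qPochInf (Q * C / v) Q * qPochInf (Q * D / v) Q)) := by
    refine isQWeight_of_div hr hQ0 hQ1 hC hD (fun v hv => (differentiableAt_qPochInf_div hQ1 ρ hv).mul
      (differentiableAt_qPochInf_div hQ1 ρ' hv)) fun v hv => ?_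
    rw [qPochInf_div_mul_pair hQ0 hQ1 hρ hv, hCD]
    ring
  have h := hw.eliminate_all hr hQ0 hQ1 hC hD
  -- The integrand depends on `1/v` only and is holomorphic for `|v| ≥ r` and at infinity, where its
  -- value is `1`.
  have h0 : poleAverage C D r (fun v => v ^ 2 * (qPochInf (ρ / v) Q * qPochInf (ρ' / v) Q) /
      (qPochInf (Q * C / v) Q * qPochInf (Q * D / v) Q)) = 1 := by
    rw [poleAverage_div hr hQ1 hC hD]
    have hi := circleAverage_comp_inv (r := r) hr (g := fun u =>
      qPochInf (ρ * u) Q * qPochInf (ρ' * u) Q / (qPochInf (C * u) Q * qPochInf (D * u) Q))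
      fun u hu => ?_
    · simpa [← div_eq_mul_inv, qPochInf_zero] using hi
    · refine ((differentiableAt_qPochInf_mul hQ1 ρ u).mul (differentiableAt_qPochInf_mul hQ1 ρ' u)).div
        ((differentiableAt_qPochInf_mul hQ1 C u).mul (differentiableAt_qPochInf_mul hQ1 D u))
        (mul_ne_zero ?_ ?_) <;>
      refine qPochInf_ne_zero_of_norm_lt_one hQ1 (norm_mul_lt_one ?_ hu) <;>
      rwa [← div_eq_mul_inv, div_lt_one hr]
  have h1 : poleAverage C D r (fun v => v ^ 2 * thetaPair Q ρ ρ' v /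
      (qPochInf (Q * C / v) Q * qPochInf (Q * D / v) Q)) = _ := poleAverage_div hr hQ1 hC hD _
  rw [← h1]
  simp only [mul_zero, zero_mul, qPochInf_zero, mul_one, h0] at h
  rw [h, mul_assoc (ρ * ρ'), hCD, hρ, mul_one]
  congr 2
  funext v
  rw [thetaPair]
  ring

/-- What vanishes is the average of `Ψ(v)(C + D - v)/((v-C)(v-D))`, which is that of `G(Qv) - G(v)`
with `G = Ψ/v`. -/
theorem IsQWeight.poleAverage_eq_zero (hr : 0 < r) (hQ0 : Q ≠ 0) (hQ1 : ‖Q‖ < 1) (hC : ‖C‖ < r)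
    (hD : ‖D‖ < r) (h : IsQWeight Q C D 0 0 0 r Ψ) :
    poleAverage C D r (fun v => Ψ v * (v - D)) = C * poleAverage C D r Ψ := by
  have hQn : 0 < ‖Q‖ := norm_pos_iff.2 hQ0
  set G : ℂ → ℂ := fun v => Ψ v / v with hGdef
  have hGd : ∀ v, ‖Q‖ * r ≤ ‖v‖ → ‖v‖ ≤ r → DifferentiableAt ℂ G v := fun v h1 h2 =>
    (h.differentiableAt v h1 h2).div differentiableAt_id (ne_zero_of_mul_le_norm hr hQ0 h1)
  have hG := circleAverage_comp_mul_left hr hQ0 hQ1 hGd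
  have h1 := circleIntegrable_pole hr hQ1 hC hD h.differentiableAt
  have h0 := circleIntegrable_pole hr hQ1 hC hD (Ψ := fun v => Ψ v * (v - D)) fun v h1 h2 =>
    (h.differentiableAt v h1 h2).mul (by fun_prop)
  have hle : ‖Q‖ * r ≤ r := by nlinarith
  have hGi : CircleIntegrable G 0 r := by
    refine Continuous.intervalIntegrable ?_ _ _
    rw [continuous_iff_continuousAt]
    intro θ
    refine ContinuousAt.comp (g := G) (hGd _ ?_ ?_).continuousAt (by fun_prop) <;>
      simp [abs_of_pos hr, hle]
  have key : circleAverage (fun v => G (Q * v)) 0 r = circleAverage (fun v => G v +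
      (C * (Ψ v / ((v - C) * (v - D))) - Ψ v * (v - D) / ((v - C) * (v - D)))) 0 r := by
    refine circleAverage_congr_sphere fun v hv => ?_
    rw [mem_sphere_zero_iff_norm, abs_of_pos hr] at hv
    have hv0 : v ≠ 0 := norm_pos_iff.1 (by rw [hv]; exact hr)
    have hvC := sub_ne_zero_of_norm hC hv
    have hvD := sub_ne_zero_of_norm hD hv
    have he : Ψ (Q * v) = C * D * Q * Ψ v / ((v - C) * (v - D)) := by
      rw [eq_div_iff (mul_ne_zero hvC hvD), h.eq v hv]
      ring
    simp only [hGdef, he]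
    field_simp
    ring
  have h2 : CircleIntegrable (fun v => C * (Ψ v / ((v - C) * (v - D))) -
      Ψ v * (v - D) / ((v - C) * (v - D))) 0 r := (h1.const_mul C).sub h0
  rw [hG, circleAverage_fun_add hGi h2,
    circleAverage_fun_sub (h1.const_mul C) h0, circleAverage_const_mul] at key
  simp only [poleAverage]
  linear_combination key

theorem isQWeight_thetaPair (hr : 0 < r) (hQ0 : Q ≠ 0) (hQ1 : ‖Q‖ < 1) (hC : ‖C‖ < r)
    (hD : ‖D‖ < r) (hρ : ρ * ρ' = Q) (i : ℕ) (hCD : C * D = Q ^ i) :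
    IsQWeight Q C D 0 0 0 r (fun v => v ^ 2 * (v ^ i * thetaPair Q ρ ρ' v) /
      (qPochInf (Q * C / v) Q * qPochInf (Q * D / v) Q)) := by
  refine isQWeight_of_div hr hQ0 hQ1 hC hD
    (fun v hv => (differentiableAt_pow i).mul (differentiableAt_thetaPair hQ1 hv)) fun v hv => ?_
  rw [hCD]
  linear_combination (Q * v) ^ i * thetaPair_mul_left hQ0 hQ1 hρ hv

theorem norm_mul_pow_le (hQ1 : ‖Q‖ < 1) (D : ℂ) (i : ℕ) : ‖D * Q ^ i‖ ≤ ‖D‖ := by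
  rw [norm_mul, norm_pow]
  exact mul_le_of_le_one_right (norm_nonneg _) (pow_le_one₀ (norm_nonneg _) hQ1.le)

/-- Multiplying by `v - DQ^i` turns the denominator `(DQ^i/v;Q)_∞` into `(DQ^{i+1}/v;Q)_∞` and adds
a power of `v`. By the previous relation each such step contributes one factor `C`. -/
theorem circleAverage_pow_mul_thetaPair (hr : 0 < r) (hQ0 : Q ≠ 0) (hQ1 : ‖Q‖ < 1) (hC : ‖C‖ < r)
    (hD : ‖D‖ < r) (hCD : C * D = 1) (hρ : ρ * ρ' = Q) (i : ℕ) :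
    circleAverage (fun v => v ^ i * thetaPair Q ρ ρ' v /
        (qPochInf (C / v) Q * qPochInf (D * Q ^ i / v) Q)) 0 r =
      C ^ i * circleAverage (fun v => thetaPair Q ρ ρ' v /
        (qPochInf (C / v) Q * qPochInf (D / v) Q)) 0 r := by
  induction i with
  | zero => simp
  | succ i ih =>
    have hDi : ∀ i : ℕ, ‖D * Q ^ i‖ < r := fun i => (norm_mul_pow_le hQ1 D i).trans_lt hD
    have hw := (isQWeight_thetaPair hr hQ0 hQ1 hC (hDi i) hρ i
      (by rw [← mul_assoc, hCD, one_mul])).poleAverage_eq_zero hr hQ0 hQ1 hC (hDi i)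
    rw [poleAverage_div hr hQ1 hC (hDi i), ih] at hw
    rw [pow_succ' C, mul_assoc, ← hw]
    refine circleAverage_congr_sphere fun v hv => ?_
    rw [mem_sphere_zero_iff_norm, abs_of_pos hr] at hv
    have hv0 : v ≠ 0 := norm_pos_iff.1 (by rw [hv]; exact hr)
    have e1 := qPochInf_div_eq (C := C) hQ1 hv0
    have n1 := qPochInf_ne_zero_of_norm_lt_one hQ1 (norm_div_lt_one hr hC hv)
    have n2 := qPochInf_ne_zero_of_norm_lt_one hQ1 (norm_div_lt_one hr (hDi (i + 1)) hv)
    have m1 : (v - C) * qPochInf (Q * C / v) Q ≠ 0 := e1 ▸ mul_ne_zero n1 hv0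
    have hvD := sub_ne_zero_of_norm (hDi i) hv
    have e3 : D * Q ^ (i + 1) / v = Q * (D * Q ^ i) / v := by ring
    simp only
    rw [e3] at n2 ⊢
    rw [div_mul_eq_mul_div, div_div, div_eq_div_iff (mul_ne_zero n1 n2)
      (mul_ne_zero (mul_ne_zero (right_ne_zero_of_mul m1) n2)
        (mul_ne_zero (left_ne_zero_of_mul m1) hvD))]
    linear_combination (-(v ^ (i + 1) * thetaPair Q ρ ρ' v * qPochInf (Q * (D * Q ^ i) / v) Q *
      (v - D * Q ^ i))) * e1

theorem IsQWeight.div_qPochInf (hQ1 : ‖Q‖ < 1) (hA : ‖A‖ * r < 1) (hB : ‖B‖ * r < 1)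
    (hF : ‖F‖ * r < 1) (h : IsQWeight Q C D 0 0 0 r Ψ) :
    IsQWeight Q C D A B F r
      (fun v => Ψ v / (qPochInf (A * v) Q * qPochInf (B * v) Q * qPochInf (F * v) Q)) := by
  have hne : ∀ {A : ℂ}, ‖A‖ * r < 1 → ∀ {v : ℂ}, ‖v‖ ≤ r → qPochInf (A * v) Q ≠ 0 :=
    fun hA _ hv => qPochInf_ne_zero_of_norm_lt_one hQ1 (norm_mul_lt_one hA hv)
  refine ⟨fun v h1 h2 => ?_, fun v hv => ?_⟩
  · exact (h.differentiableAt v h1 h2).div (((differentiableAt_qPochInf_mul hQ1 _ _).mul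
      (differentiableAt_qPochInf_mul hQ1 _ _)).mul (differentiableAt_qPochInf_mul hQ1 _ _))
      (mul_ne_zero (mul_ne_zero (hne hA h2) (hne hB h2)) (hne hF h2))
  · have e : ∀ A : ℂ, qPochInf (A * v) Q = (1 - A * v) * qPochInf (A * (Q * v)) Q := fun A => by
      rw [show A * (Q * v) = A * v * Q by ring, ← qPochInf_eq_one_sub_mul _ hQ1]
    have hA' := hne hA hv.le
    have hB' := hne hB hv.le
    have hF' := hne hF hv.le
    have heq := h.eq v hv
    simp only [e A, e B, e F] at *
    have a1 := left_ne_zero_of_mul hA'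
    have a2 := right_ne_zero_of_mul hA'
    have b1 := left_ne_zero_of_mul hB'
    have b2 := right_ne_zero_of_mul hB'
    have f1 := left_ne_zero_of_mul hF'
    have f2 := right_ne_zero_of_mul hF'
    simp only [zero_mul, sub_zero, mul_one] at heq
    rw [div_mul_eq_mul_div, heq]
    generalize qPochInf (A * (Q * v)) Q = a at *
    generalize qPochInf (B * (Q * v)) Q = b at *
    generalize qPochInf (F * (Q * v)) Q = f at *
    generalize 1 - A * v = x at *
    generalize 1 - B * v = y at *
    generalize 1 - F * v = z at *
    field_simp

end

/-! ### Moments of the weight and an adapted polynomial basis -/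

section

variable {Q C D A B F ρ ρ' : ℂ} {r : ℝ}

/-- The weight function of the Askey–Roy type integral. -/
noncomputable def arWeight (Q C D A B F ρ ρ' v : ℂ) : ℂ :=
  thetaPair Q ρ ρ' v / (qPochInf (C / v) Q * qPochInf (D / v) Q *
    (qPochInf (A * v) Q * qPochInf (B * v) Q * qPochInf (F * v) Q))

/-- The polynomial `(v - c)(v - cQ)⋯(v - cQ^{n-1})`. -/
noncomputable def shiftProd (c Q v : ℂ) (n : ℕ) : ℂ := ∏ l ∈ Finset.range n, (v - c * Q ^ l)

theorem shiftProd_succ (c Q v : ℂ) (n : ℕ) :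
    shiftProd c Q v (n + 1) = shiftProd c Q v n * (v - c * Q ^ n) :=
  Finset.prod_range_succ _ _

theorem shiftProd_eq (c Q : ℂ) {v : ℂ} (hv : v ≠ 0) (n : ℕ) :
    shiftProd c Q v n = v ^ n * qPoch (c / v) Q n := by
  rw [shiftProd, qPoch, ← Finset.card_range n, ← Finset.prod_const, Finset.card_range,
    ← Finset.prod_mul_distrib]
  refine Finset.prod_congr rfl fun l _ => ?_
  field_simp

theorem norm_mul_lt_one_of_lt (hA : ‖A‖ * r < 1) (hC : ‖C‖ < r) : ‖A * C‖ < 1 :=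
  norm_mul_lt_one hA hC.le

theorem norm_mul_mul_lt_one (hQ1 : ‖Q‖ < 1) (hr : 0 < r) (hA : ‖A‖ * r < 1) (j : ℕ) :
    ‖A * Q ^ j‖ * r < 1 :=
  lt_of_le_of_lt (by gcongr; exact norm_mul_pow_le hQ1 A j) hA

/-- The factor `(Av;Q)_j` turns `A` into `AQ^j`, and `(v-D)⋯(v-DQ^{i-1}) = v^i (D/v;Q)_i` turns `D`
into `DQ^i` up to `v^i`. The result is again a weight because `v^i` and the changed product `C·DQ^i
= Q^i` compensate each other in the difference equation, so all three parameters can be eliminated.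
-/
theorem circleAverage_arWeight_aux (hr : 0 < r) (hQ0 : Q ≠ 0) (hQ1 : ‖Q‖ < 1) (hC : ‖C‖ < r)
    (hD : ‖D‖ < r) (hA : ‖A‖ * r < 1) (hB : ‖B‖ * r < 1) (hF : ‖F‖ * r < 1) (hCD : C * D = 1)
    (hρ : ρ * ρ' = Q) (i j : ℕ) :
    qPochInf (A * C * Q ^ j) Q * qPochInf (A * D * Q ^ (j + i)) Q *
        (qPochInf (B * C) Q * qPochInf (B * D * Q ^ i) Q) *
        (qPochInf (F * C) Q * qPochInf (F * D * Q ^ i) Q) *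
        circleAverage (fun v => arWeight Q C D A B F ρ ρ' v * (qPoch (A * v) Q j *
          shiftProd D Q v i * qPochInf (A * B * F * v * Q ^ (j + i)) Q)) 0 r =
      qPochInf (A * B * Q ^ (j + i)) Q * qPochInf (A * F * Q ^ (j + i)) Q *
        qPochInf (B * F * Q ^ i) Q * (C ^ i * circleAverage (fun v => thetaPair Q ρ ρ' v /
          (qPochInf (C / v) Q * qPochInf (D / v) Q)) 0 r) := by
  have hDi : ‖D * Q ^ i‖ < r := (norm_mul_pow_le hQ1 D i).trans_lt hD
  have hCDi : C * (D * Q ^ i) = Q ^ i := by rw [← mul_assoc, hCD, one_mul]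
  have hAj := norm_mul_mul_lt_one hQ1 hr hA j
  have hw := isQWeight_thetaPair hr hQ0 hQ1 hC hDi hρ i hCDi
  have h := (hw.div_qPochInf hQ1 hAj hB hF).eliminate_all hr hQ0 hQ1 hC hDi
  have hne : ∀ {A : ℂ}, ‖A‖ * r < 1 → ∀ {v : ℂ}, ‖v‖ = r → qPochInf (A * v) Q ≠ 0 :=
    fun hA _ hv => qPochInf_ne_zero_of_norm_lt_one hQ1 (norm_mul_lt_one hA hv.le)
  have e1 := poleAverage_congr (C := C) (D := D * Q ^ i) hr
    (Ψ := fun v => v ^ 2 * (v ^ i * thetaPair Q ρ ρ' v) /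
      (qPochInf (Q * C / v) Q * qPochInf (Q * (D * Q ^ i) / v) Q) /
        (qPochInf (A * Q ^ j * v) Q * qPochInf (B * v) Q * qPochInf (F * v) Q) *
          qPochInf (A * Q ^ j * v) Q * qPochInf (B * v) Q * qPochInf (F * v) Q)
    (Ψ' := fun v => v ^ 2 * (v ^ i * thetaPair Q ρ ρ' v) /
      (qPochInf (Q * C / v) Q * qPochInf (Q * (D * Q ^ i) / v) Q)) fun v hv => by
        have h1 := hne hAj hv
        have h2 := hne hB hv
        have h3 := hne hF hv
        rw [mul_assoc _ (qPochInf (A * Q ^ j * v) Q), mul_assoc _ (_ * _)]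
        exact div_mul_cancel₀ _ (mul_ne_zero (mul_ne_zero h1 h2) h3)
  rw [poleAverage_div hr hQ1 hC hDi, circleAverage_pow_mul_thetaPair hr hQ0 hQ1 hC hD hCD hρ] at e1
  have e2 := poleAverage_congr (C := C) (D := D * Q ^ i) hr
    (Ψ := fun v => v ^ 2 * (v ^ i * thetaPair Q ρ ρ' v) /
      (qPochInf (Q * C / v) Q * qPochInf (Q * (D * Q ^ i) / v) Q) /
        (qPochInf (A * Q ^ j * v) Q * qPochInf (B * v) Q * qPochInf (F * v) Q) *
        qPochInf (A * Q ^ j * B * C * (D * Q ^ i) * F * v) Q)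
    (Ψ' := fun v => v ^ 2 * (v ^ i * thetaPair Q ρ ρ' v *
        qPochInf (A * B * F * v * Q ^ (j + i)) Q /
        (qPochInf (A * Q ^ j * v) Q * qPochInf (B * v) Q * qPochInf (F * v) Q)) /
      (qPochInf (Q * C / v) Q * qPochInf (Q * (D * Q ^ i) / v) Q)) fun v hv => by
        rw [show A * Q ^ j * B * C * (D * Q ^ i) * F * v = A * B * F * v * Q ^ (j + i) by
          rw [pow_add]; linear_combination A * B * F * v * Q ^ j * hCDi]
        ring
  rw [poleAverage_div hr hQ1 hC hDi] at e2
  have e3 : circleAverage (fun v => v ^ i * thetaPair Q ρ ρ' v *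
        qPochInf (A * B * F * v * Q ^ (j + i)) Q /
        (qPochInf (A * Q ^ j * v) Q * qPochInf (B * v) Q * qPochInf (F * v) Q) /
        (qPochInf (C / v) Q * qPochInf (D * Q ^ i / v) Q)) 0 r =
      circleAverage (fun v => arWeight Q C D A B F ρ ρ' v * (qPoch (A * v) Q j *
          shiftProd D Q v i * qPochInf (A * B * F * v * Q ^ (j + i)) Q)) 0 r := by
    refine circleAverage_congr_sphere fun v hv => ?_
    rw [mem_sphere_zero_iff_norm, abs_of_pos hr] at hv
    have hv0 : v ≠ 0 := norm_pos_iff.1 (by rw [hv]; exact hr)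
    have n1 := hne hAj hv
    have n2 := hne hB hv
    have n3 := hne hF hv
    have n4 := hne hA hv
    have n5 := qPochInf_ne_zero_of_norm_lt_one hQ1 (norm_div_lt_one hr hC hv)
    have n6 := qPochInf_ne_zero_of_norm_lt_one hQ1 (norm_div_lt_one hr hD hv)
    have n7 := qPochInf_ne_zero_of_norm_lt_one hQ1 (norm_div_lt_one hr hDi hv)
    have p1 := qPoch_mul_qPochInf (A * v) hQ1 j
    have p2 := qPoch_mul_qPochInf (D / v) hQ1 i
    rw [show A * v * Q ^ j = A * Q ^ j * v by ring] at p1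
    rw [show D / v * Q ^ i = D * Q ^ i / v by ring] at p2
    simp only [arWeight, shiftProd_eq D Q hv0]
    rw [← p1] at n4 ⊢
    rw [← p2] at n6 ⊢
    have m1 := left_ne_zero_of_mul n4
    have m2 := left_ne_zero_of_mul n6
    generalize qPochInf (A * Q ^ j * v) Q = x1 at *
    generalize qPochInf (B * v) Q = x2 at *
    generalize qPochInf (F * v) Q = x3 at *
    generalize qPochInf (C / v) Q = x4 at *
    generalize qPochInf (D * Q ^ i / v) Q = x5 at *
    generalize qPoch (A * v) Q j = x6 at *
    generalize qPoch (D / v) Q i = x7 at *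
    generalize qPochInf (A * B * F * v * Q ^ (j + i)) Q = x8 at *
    field_simp
  rw [e3] at e2
  rw [e1, e2] at h
  rw [show A * Q ^ j * C = A * C * Q ^ j by ring,
    show A * Q ^ j * (D * Q ^ i) = A * D * Q ^ (j + i) by ring,
    show B * (D * Q ^ i) = B * D * Q ^ i by ring, show F * (D * Q ^ i) = F * D * Q ^ i by ring,
    show A * Q ^ j * B * C * (D * Q ^ i) = A * B * Q ^ (j + i) by
      rw [pow_add]; linear_combination A * B * Q ^ j * hCDi,
    show A * C * Q ^ j * (D * Q ^ i) * F = A * F * Q ^ (j + i) by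
      rw [pow_add]; linear_combination A * F * Q ^ j * hCDi,
    show B * C * (D * Q ^ i) * F = B * F * Q ^ i by linear_combination B * F * hCDi] at h
  exact h

/-- The value of the Askey–Roy type integral. -/
noncomputable def arValue (Q C D A B F ρ ρ' : ℂ) : ℂ :=
  qPochInf (A * B) Q * qPochInf (A * F) Q * qPochInf (B * F) Q *
    (qPochInf (ρ * C) Q * qPochInf (ρ * D) Q * (qPochInf (ρ' * C) Q * qPochInf (ρ' * D) Q)) /
  (qPochInf Q Q * (qPochInf (A * C) Q * qPochInf (A * D) Q) *
    (qPochInf (B * C) Q * qPochInf (B * D) Q) * (qPochInf (F * C) Q * qPochInf (F * D) Q))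

theorem norm_mul_lt_one_of_mul_eq_one (hCD : C * D = 1) (hC : ‖C‖ < r) (hD : ‖D‖ < r)
    (hA : ‖A‖ * r < 1) (hB : ‖B‖ * r < 1) : ‖A * B‖ < 1 := by
  rw [show A * B = A * C * (B * D) by linear_combination -(A * B) * hCD, norm_mul]
  have h1 := norm_mul_lt_one_of_lt hA hC
  have h2 := norm_mul_lt_one_of_lt hB hD
  nlinarith [norm_nonneg (A * C), norm_nonneg (B * D)]

theorem circleAverage_arWeight (hr : 0 < r) (hQ0 : Q ≠ 0) (hQ1 : ‖Q‖ < 1) (hC : ‖C‖ < r)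
    (hD : ‖D‖ < r) (hA : ‖A‖ * r < 1) (hB : ‖B‖ * r < 1) (hF : ‖F‖ * r < 1) (hCD : C * D = 1)
    (hρ : ρ * ρ' = Q) (i j : ℕ) :
    circleAverage (fun v => arWeight Q C D A B F ρ ρ' v * (qPoch (A * v) Q j *
        shiftProd D Q v i * qPochInf (A * B * F * v * Q ^ (j + i)) Q)) 0 r =
      arValue Q C D A B F ρ ρ' * (C ^ i * (qPoch (A * C) Q j * qPoch (A * D) Q (j + i) *
        qPoch (B * D) Q i * qPoch (F * D) Q i) /
        (qPoch (A * B) Q (j + i) * qPoch (A * F) Q (j + i) * qPoch (B * F) Q i)) := by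
  have h := circleAverage_arWeight_aux hr hQ0 hQ1 hC hD hA hB hF hCD hρ i j
  have hJ := circleAverage_thetaPair hr hQ0 hQ1 hC hD hCD hρ
  have nQ := qPochInf_ne_zero_of_norm_lt_one hQ1 hQ1
  have n1 := qPochInf_ne_zero_of_norm_lt_one hQ1 (norm_mul_lt_one_of_lt hA hC)
  have n2 := qPochInf_ne_zero_of_norm_lt_one hQ1 (norm_mul_lt_one_of_lt hA hD)
  have n3 := qPochInf_ne_zero_of_norm_lt_one hQ1 (norm_mul_lt_one_of_lt hB hC)
  have n4 := qPochInf_ne_zero_of_norm_lt_one hQ1 (norm_mul_lt_one_of_lt hB hD)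
  have n5 := qPochInf_ne_zero_of_norm_lt_one hQ1 (norm_mul_lt_one_of_lt hF hC)
  have n6 := qPochInf_ne_zero_of_norm_lt_one hQ1 (norm_mul_lt_one_of_lt hF hD)
  have n7 := qPoch_ne_zero_of_norm_lt_one hQ1 (norm_mul_lt_one_of_mul_eq_one hCD hC hD hA hB) (j + i)
  have n8 := qPoch_ne_zero_of_norm_lt_one hQ1 (norm_mul_lt_one_of_mul_eq_one hCD hC hD hA hF) (j + i)
  have n9 := qPoch_ne_zero_of_norm_lt_one hQ1 (norm_mul_lt_one_of_mul_eq_one hCD hC hD hB hF) i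
  have p1 := qPoch_mul_qPochInf (A * C) hQ1 j
  have p2 := qPoch_mul_qPochInf (A * D) hQ1 (j + i)
  have p4 := qPoch_mul_qPochInf (B * D) hQ1 i
  have p6 := qPoch_mul_qPochInf (F * D) hQ1 i
  have p7 := qPoch_mul_qPochInf (A * B) hQ1 (j + i)
  have p8 := qPoch_mul_qPochInf (A * F) hQ1 (j + i)
  have p9 := qPoch_mul_qPochInf (B * F) hQ1 i
  rw [mul_comm, ← eq_div_iff nQ] at hJ
  rw [hJ] at h
  rw [arValue]
  rw [← p1] at n1
  rw [← p2] at n2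
  rw [← p4] at n4
  rw [← p6] at n6
  rw [← p1, ← p2, ← p4, ← p6, ← p7, ← p8, ← p9]
  clear p1 p2 p4 p6 p7 p8 p9 hJ
  generalize circleAverage (fun v => arWeight Q C D A B F ρ ρ' v * (qPoch (A * v) Q j *
        shiftProd D Q v i * qPochInf (A * B * F * v * Q ^ (j + i)) Q)) 0 r = J at *
  have m1 := right_ne_zero_of_mul n1
  have m2 := right_ne_zero_of_mul n2
  have m4 := right_ne_zero_of_mul n4
  have m6 := right_ne_zero_of_mul n6
  have l1 := left_ne_zero_of_mul n1
  have l2 := left_ne_zero_of_mul n2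
  have l4 := left_ne_zero_of_mul n4
  have l6 := left_ne_zero_of_mul n6
  clear n1 n2 n4 n6
  generalize qPochInf (A * C * Q ^ j) Q = x1 at *
  generalize qPochInf (A * D * Q ^ (j + i)) Q = x2 at *
  generalize qPochInf (B * C) Q = x3 at *
  generalize qPochInf (B * D * Q ^ i) Q = x4 at *
  generalize qPochInf (F * C) Q = x5 at *
  generalize qPochInf (F * D * Q ^ i) Q = x6 at *
  generalize qPoch (A * B) Q (j + i) = y7 at *
  generalize qPoch (A * F) Q (j + i) = y8 at *
  generalize qPoch (B * F) Q i = y9 at *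
  generalize qPochInf (A * B * Q ^ (j + i)) Q = x7 at *
  generalize qPochInf (A * F * Q ^ (j + i)) Q = x8 at *
  generalize qPochInf (B * F * Q ^ i) Q = x9 at *
  generalize qPoch (A * C) Q j = y1 at *
  generalize qPoch (A * D) Q (j + i) = y2 at *
  generalize qPoch (B * D) Q i = y4 at *
  generalize qPoch (F * D) Q i = y6 at *
  generalize qPochInf Q Q = z at *
  generalize (qPochInf (ρ * C) Q * qPochInf (ρ * D) Q * (qPochInf (ρ' * C) Q * qPochInf (ρ' * D) Q)) = t at *
  have hne : x1 * x2 * (x3 * x4) * (x5 * x6) ≠ 0 := by simp [*]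
  refine mul_left_cancel₀ hne (h.trans ?_)
  field_simp

/-- The coefficients of the expansion of `(v - c)(v - cQ)⋯` in terms of
`(Av;Q)_j (v - D)(v - DQ)⋯(v - DQ^{i-1})`. -/
noncomputable def expCoeff (Q A D c : ℂ) (j i : ℕ) : ℂ :=
  qPoch Q Q (j + i) * qPoch (A * c) Q (j + i) * shiftProd c Q D j /
    (qPoch Q Q j * qPoch Q Q i * qPoch (A * c) Q j * qPoch (A * D) Q (j + i))

theorem shiftProd_expansion {c : ℂ} (hQ : ∀ n, qPoch Q Q n ≠ 0) (hAc : ∀ n, qPoch (A * c) Q n ≠ 0)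
    (hAD : ∀ n, qPoch (A * D) Q n ≠ 0) (v : ℂ) (k : ℕ) :
    shiftProd c Q v k = ∑ p ∈ Finset.HasAntidiagonal.antidiagonal k,
      expCoeff Q A D c p.1 p.2 * (qPoch (A * v) Q p.1 * shiftProd D Q v p.2) := by
  induction k with
  | zero => simp [expCoeff, shiftProd, qPoch_zero]
  | succ k ih =>
    set M : ℂ := (1 - Q ^ (k + 1)) * (1 - A * c * Q ^ k) with hM
    have hQk := hQ (k + 1)
    have hAck := hAc (k + 1)
    rw [qPoch_succ] at hQk hAck
    have hM0 : M ≠ 0 := by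
      refine mul_ne_zero ?_ (right_ne_zero_of_mul hAck)
      have := right_ne_zero_of_mul hQk
      rwa [← pow_succ'] at this
    have hADk := hAD (k + 1)
    rw [qPoch_succ] at hADk
    have hADk' := right_ne_zero_of_mul hADk
    set T : ℕ → ℕ → ℂ := fun j i => expCoeff Q A D c j i * (qPoch (A * v) Q j * shiftProd D Q v i)
      with hT
    set T1 : ℕ × ℕ → ℂ := fun p => T p.1 p.2 * ((1 - Q ^ p.2) * (1 - A * c * Q ^ (k + p.1)) / M)
      with hT1
    set T2 : ℕ × ℕ → ℂ := fun p => T p.1 p.2 * ((1 - Q ^ p.1) * (Q ^ p.2 - A * c * Q ^ k) / M)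
      with hT2
    -- The terms of degree `k + 1` are split so that one part comes from raising `i` and the other
    -- from raising `j` in degree `k`. The parts vanish at `i = 0` and `j = 0` respectively, so both
    -- reindex over the antidiagonal of `k`.
    have hsplit : ∀ p ∈ Finset.HasAntidiagonal.antidiagonal (k + 1), T p.1 p.2 = T1 p + T2 p := by
      rintro ⟨j, i⟩ hp
      rw [Finset.HasAntidiagonal.mem_antidiagonal] at hp
      have : (1 - Q ^ i) * (1 - A * c * Q ^ (k + j)) + (1 - Q ^ j) * (Q ^ i - A * c * Q ^ k) = M := by
        have e : Q ^ j * Q ^ i = Q ^ (k + 1) := by rw [← pow_add, hp]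
        rw [hM, pow_add]
        linear_combination (A * c * Q ^ k - 1) * e
      simp only [hT1, hT2]
      rw [← mul_add, ← add_div, this, div_self hM0, mul_one]
    rw [shiftProd_succ, ih, Finset.sum_congr rfl hsplit, Finset.sum_add_distrib,
      Finset.Nat.sum_antidiagonal_succ', Finset.Nat.sum_antidiagonal_succ (f := T2)]
    simp only [hT1, hT2, pow_zero, sub_self, zero_mul, zero_div, mul_zero, zero_add]
    rw [← Finset.sum_add_distrib, Finset.sum_mul]
    refine Finset.sum_congr rfl ?_
    rintro ⟨j, i⟩ hp
    rw [Finset.HasAntidiagonal.mem_antidiagonal] at hp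
    simp only at hp
    subst hp
    have h1 := hQ (j + 1)
    have h2 := hQ (i + 1)
    have h3 := hAc (j + 1)
    have h4 := hAc (j + i)
    have h5 := hQ (j + i)
    have h6 := hAD (j + i)
    rw [qPoch_succ] at h1 h2 h3
    -- The new linear factor is a combination of the next factor in `D` and the next factor in `A`.
    have key : (v - c * Q ^ (j + i)) * (1 - A * D * Q ^ (j + i)) =
        (1 - A * c * Q ^ (j + i + j)) * (v - D * Q ^ i) +
          Q ^ i * (D - c * Q ^ j) * (1 - A * v * Q ^ j) := by ring
    simp only [hT, expCoeff]
    rw [show j + (i + 1) = j + i + 1 by ring, show j + 1 + i = j + i + 1 by ring]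
    simp only [qPoch_succ, shiftProd_succ] at *
    have a1 := left_ne_zero_of_mul h1
    have a2 := right_ne_zero_of_mul h1
    have b1 := left_ne_zero_of_mul h2
    have b2 := right_ne_zero_of_mul h2
    have c1 := left_ne_zero_of_mul h3
    have c2 := right_ne_zero_of_mul h3
    have d1 := right_ne_zero_of_mul hQk
    have d2 := right_ne_zero_of_mul hAck
    have hc1 : (1 - Q * Q ^ i) = 1 - Q ^ (i + 1) := by rw [pow_succ']
    have hc2 : (1 - Q * Q ^ j) = 1 - Q ^ (j + 1) := by rw [pow_succ']
    have hc3 : (1 - Q * Q ^ (j + i)) = 1 - Q ^ (j + i + 1) := by rw [pow_succ']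
    have hc4 : Q ^ i - A * c * Q ^ (j + i) = Q ^ i * (1 - A * c * Q ^ j) := by ring
    rw [hc4, hM, ← hc1, ← hc2, ← hc3]
    generalize v - c * Q ^ (j + i) = s1 at *
    generalize v - D * Q ^ i = s2 at *
    generalize D - c * Q ^ j = s3 at *
    generalize 1 - A * v * Q ^ j = s4 at *
    generalize 1 - A * D * Q ^ (j + i) = s5 at *
    generalize 1 - A * c * Q ^ (j + i + j) = s6 at *
    generalize 1 - Q * Q ^ i = s7 at *
    generalize 1 - Q * Q ^ j = s8 at *
    generalize 1 - Q * Q ^ (j + i) = s9 at *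
    generalize 1 - A * c * Q ^ j = s10 at *
    generalize 1 - A * c * Q ^ (j + i) = s11 at *
    generalize qPoch Q Q (j + i) = y1 at *
    generalize qPoch Q Q j = y2 at *
    generalize qPoch Q Q i = y3 at *
    generalize qPoch (A * c) Q (j + i) = y4 at *
    generalize qPoch (A * c) Q j = y5 at *
    generalize qPoch (A * D) Q (j + i) = y6 at *
    generalize Q ^ i = y7 at *
    have : s1 = (s6 * s2 + y7 * s3 * s4) / s5 := by rw [eq_div_iff hADk', key]
    rw [this]
    field_simp

end

/-! ### Termwise integration of the `₃φ₂` -/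

section

variable {Q C D A B F ρ ρ' c y : ℂ} {r : ℝ}

theorem integral_comp_circleMap (g : ℂ → ℂ) (r : ℝ) :
    ∫ θ in (-π)..π, g (circleMap 0 r θ) = 2 * (π : ℂ) * circleAverage g 0 r := by
  have hp : Function.Periodic (fun θ => g (circleMap 0 r θ)) (2 * π) := fun x => by
    simp only [periodic_circleMap 0 r x]
  have h := hp.intervalIntegral_add_eq (-π) 0
  rw [show -π + 2 * π = π by ring, zero_add] at h
  rw [h, circleAverage_def, Complex.real_smul]
  push_cast
  have : (π : ℂ) ≠ 0 := by exact_mod_cast Real.pi_ne_zero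
  field_simp

theorem continuous_arWeight (hr : 0 < r) (hQ1 : ‖Q‖ < 1) (hC : ‖C‖ < r)
    (hD : ‖D‖ < r) (hA : ‖A‖ * r < 1) (hB : ‖B‖ * r < 1) (hF : ‖F‖ * r < 1) :
    Continuous fun θ : ℝ => arWeight Q C D A B F ρ ρ' (circleMap 0 r θ) := by
  have hn : ∀ θ, ‖circleMap 0 r θ‖ = r := fun θ => by simp [abs_of_pos hr]
  rw [continuous_iff_continuousAt]
  intro θ
  refine ContinuousAt.comp (g := arWeight Q C D A B F ρ ρ') (DifferentiableAt.continuousAt (𝕜 := ℂ) ?_)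
    (continuous_circleMap 0 r).continuousAt
  have h0 : circleMap 0 r θ ≠ 0 := norm_pos_iff.1 (by rw [hn]; exact hr)
  refine (differentiableAt_thetaPair hQ1 h0).div
    (((differentiableAt_qPochInf_div hQ1 C h0).mul (differentiableAt_qPochInf_div hQ1 D h0)).mul
    (((differentiableAt_qPochInf_mul hQ1 A _).mul (differentiableAt_qPochInf_mul hQ1 B _)).mul
      (differentiableAt_qPochInf_mul hQ1 F _))) ?_
  have h1 : ∀ {A : ℂ}, ‖A‖ * r < 1 → qPochInf (A * circleMap 0 r θ) Q ≠ 0 := fun hA =>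
    qPochInf_ne_zero_of_norm_lt_one hQ1 (norm_mul_lt_one hA (hn θ).le)
  have h2 : ∀ {C : ℂ}, ‖C‖ < r → qPochInf (C / circleMap 0 r θ) Q ≠ 0 := fun hC =>
    qPochInf_ne_zero_of_norm_lt_one hQ1 (norm_div_lt_one hr hC (hn θ))
  exact mul_ne_zero (mul_ne_zero (h2 hC) (h2 hD)) (mul_ne_zero (mul_ne_zero (h1 hA) (h1 hB)) (h1 hF))

/-- The `k`-th term of the integrand, without the weight, after cancellation of the infinite
product in the numerator against the denominator of the series. -/
noncomputable def arTerm (Q A B F c y v : ℂ) (k : ℕ) : ℂ :=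
  qPoch (A * B) Q k * qPoch (A * F) Q k / (qPoch Q Q k * qPoch (A * c) Q k) * y ^ k *
    (shiftProd c Q v k * qPochInf (A * B * F * v * Q ^ k) Q)

theorem qPochInf_mul_qHypTerm (hQ1 : ‖Q‖ < 1) {v : ℂ} (hv : v ≠ 0) (k : ℕ)
    (hne : qPoch (A * B * F * v) Q k ≠ 0) :
    qPochInf (A * B * F * v) Q *
      qHypTerm [A * B, A * F, c / v] [A * c, A * B * F * v] Q (y * v) k =
      arTerm Q A B F c y v k := by
  rw [qHypTerm_balanced rfl, arTerm, shiftProd_eq c Q hv, ← qPoch_mul_qPochInf (A * B * F * v) hQ1 k]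
  simp only [qPochList, List.map_cons, List.map_nil, List.prod_cons, List.prod_nil, mul_one]
  generalize qPochInf (A * B * F * v * Q ^ k) Q = x1
  generalize qPoch (A * B * F * v) Q k = x2 at *
  rw [mul_pow, ← mul_assoc (qPoch Q Q k), ← div_div]
  field_simp

/-- In the expansion coefficient times the moment, the factorials of `Q`, `Ac`, `AD`, `AB`, `AF` of
order `j + i` all cancel, and what is left is a function of `j` times a function of `i`. -/
theorem circleAverage_arTerm (hr : 0 < r) (hQ0 : Q ≠ 0) (hQ1 : ‖Q‖ < 1) (hC : ‖C‖ < r)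
    (hD : ‖D‖ < r) (hA : ‖A‖ * r < 1) (hB : ‖B‖ * r < 1) (hF : ‖F‖ * r < 1) (hCD : C * D = 1)
    (hρ : ρ * ρ' = Q) (hAc : ‖A * c‖ < 1) (z : ℂ) (k : ℕ) :
    circleAverage (fun v => arWeight Q C D A B F ρ ρ' v * arTerm Q A B F c (C * z) v k) 0 r =
      arValue Q C D A B F ρ ρ' * ∑ p ∈ Finset.HasAntidiagonal.antidiagonal k,
        qHypTerm [A * C, c * C] [A * c] Q z p.1 *
          qHypTerm [B * D, F * D] [B * F] Q (C ^ 2 * z) p.2 := by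
  have nQ := qPoch_ne_zero_of_norm_lt_one hQ1 hQ1
  have nAc := qPoch_ne_zero_of_norm_lt_one hQ1 hAc
  have nAD := qPoch_ne_zero_of_norm_lt_one hQ1 (norm_mul_lt_one_of_lt hA hD)
  have nAB := qPoch_ne_zero_of_norm_lt_one hQ1 (norm_mul_lt_one_of_mul_eq_one hCD hC hD hA hB)
  have nAF := qPoch_ne_zero_of_norm_lt_one hQ1 (norm_mul_lt_one_of_mul_eq_one hCD hC hD hA hF)
  have nBF := qPoch_ne_zero_of_norm_lt_one hQ1 (norm_mul_lt_one_of_mul_eq_one hCD hC hD hB hF)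
  have hD0 : D ≠ 0 := right_ne_zero_of_mul (hCD ▸ one_ne_zero)
  have hexp : ∀ v, arWeight Q C D A B F ρ ρ' v * arTerm Q A B F c (C * z) v k =
      ∑ p ∈ Finset.HasAntidiagonal.antidiagonal k,
        (qPoch (A * B) Q k * qPoch (A * F) Q k / (qPoch Q Q k * qPoch (A * c) Q k) * (C * z) ^ k *
          expCoeff Q A D c p.1 p.2) * (arWeight Q C D A B F ρ ρ' v * (qPoch (A * v) Q p.1 *
            shiftProd D Q v p.2 * qPochInf (A * B * F * v * Q ^ (p.1 + p.2)) Q)) := by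
    intro v
    rw [arTerm, shiftProd_expansion nQ nAc nAD v k, Finset.sum_mul, Finset.mul_sum, Finset.mul_sum]
    refine Finset.sum_congr rfl fun p hp => ?_
    rw [Finset.HasAntidiagonal.mem_antidiagonal.1 hp]
    ring
  simp only [hexp]
  rw [circleAverage_fun_sum, Finset.mul_sum]
  · refine Finset.sum_congr rfl ?_
    rintro ⟨j, i⟩ hp
    have hk := Finset.HasAntidiagonal.mem_antidiagonal.1 hp
    simp only at hk
    subst hk
    rw [circleAverage_const_mul, circleAverage_arWeight hr hQ0 hQ1 hC hD hA hB hF hCD hρ,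
      qHypTerm_balanced rfl, qHypTerm_balanced rfl, expCoeff, shiftProd_eq c Q hD0,
      show c / D = c * C by rw [div_eq_iff hD0, mul_assoc, hCD, mul_one]]
    simp only [qPochList, List.map_cons, List.map_nil, List.prod_cons, List.prod_nil, mul_one]
    -- `D^j` comes from evaluating the polynomial in `c` at `D`, `C^i` from the moment. Since `D =
    -- 1/C`, the two series get the arguments `z` and `C²z`.
    have e : (C * z) ^ (j + i) * D ^ j * C ^ i = z ^ j * (C ^ 2 * z) ^ i := by
      have : D ^ j * C ^ j = 1 := by rw [← mul_pow, mul_comm, hCD, one_pow]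
      rw [mul_pow, mul_pow, pow_add, pow_add]
      linear_combination C ^ (2 * i) * z ^ j * z ^ i * this
    have n1 := nQ (j + i)
    have n2 := nQ j
    have n3 := nQ i
    have n4 := nAc (j + i)
    have n5 := nAc j
    have n6 := nAD (j + i)
    have n7 := nAB (j + i)
    have n8 := nAF (j + i)
    have n9 := nBF i
    generalize qPoch Q Q (j + i) = x1 at *
    generalize qPoch Q Q j = x2 at *
    generalize qPoch Q Q i = x3 at *
    generalize qPoch (A * c) Q (j + i) = x4 at *
    generalize qPoch (A * c) Q j = x5 at *
    generalize qPoch (A * D) Q (j + i) = x6 at *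
    generalize qPoch (A * B) Q (j + i) = x7 at *
    generalize qPoch (A * F) Q (j + i) = x8 at *
    generalize qPoch (B * F) Q i = x9 at *
    generalize qPoch (A * C) Q j = y1 at *
    generalize qPoch (c * C) Q j = y2 at *
    generalize qPoch (B * D) Q i = y3 at *
    generalize qPoch (F * D) Q i = y4 at *
    generalize arValue Q C D A B F ρ ρ' = w at *
    calc _ = w * (y1 * y2 * y3 * y4 / (x2 * x3 * x5 * x9)) * ((C * z) ^ (j + i) * D ^ j * C ^ i) := by
          generalize (C * z) ^ (j + i) = t1
          field_simp
      _ = _ := by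
          rw [e]
          ring
  · intro p _
    refine Continuous.intervalIntegrable ?_ _ _
    refine continuous_const.mul ((continuous_arWeight hr hQ1 hC hD hA hB hF).mul ?_)
    refine Continuous.mul ?_ ((continuous_qPochInf hQ1).comp (by fun_prop))
    simp only [qPoch, shiftProd]
    fun_prop

theorem exists_norm_arTerm_le (hr : 0 < r) (hQ1 : ‖Q‖ < 1) (A B F c y : ℂ) :
    ∃ K : ℝ, ∀ k v, ‖v‖ = r → ‖arTerm Q A B F c y v k‖ ≤ K * (‖y‖ * r) ^ k := by
  obtain ⟨M1, hM1⟩ := exists_norm_inv_qPoch_le Q hQ1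
  obtain ⟨M2, hM2⟩ := exists_norm_inv_qPoch_le (A * c) hQ1
  refine ⟨Real.exp (‖A * B‖ / (1 - ‖Q‖)) * Real.exp (‖A * F‖ / (1 - ‖Q‖)) * (M1 * M2) *
    (Real.exp (‖c‖ / r / (1 - ‖Q‖)) * Real.exp (‖A * B * F‖ * r / (1 - ‖Q‖))), fun k v hv => ?_⟩
  have hv0 : v ≠ 0 := norm_pos_iff.1 (by rw [hv]; exact hr)
  have b1 := norm_qPoch_le (a := A * B) hQ1 le_rfl k
  have b2 := norm_qPoch_le (a := A * F) hQ1 le_rfl k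
  have b3 := hM1 k
  have b4 := hM2 k
  have b5 := norm_qPoch_le (a := c / v) (R := ‖c‖ / r) hQ1 (by rw [norm_div, hv]) k
  have b6 := norm_qPochInf_le (a := A * B * F * v * Q ^ k) (R := ‖A * B * F‖ * r) hQ1
    ((norm_mul_pow_le hQ1 _ k).trans (by rw [norm_mul, hv]))
  have p3 := (norm_nonneg _).trans b3
  have p4 := (norm_nonneg _).trans b4
  calc ‖arTerm Q A B F c y v k‖
      = ‖qPoch (A * B) Q k‖ * ‖qPoch (A * F) Q k‖ * (‖(qPoch Q Q k)⁻¹‖ * ‖(qPoch (A * c) Q k)⁻¹‖) *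
        (‖qPoch (c / v) Q k‖ * ‖qPochInf (A * B * F * v * Q ^ k) Q‖) * (‖y‖ * r) ^ k := by
        rw [arTerm, shiftProd_eq c Q hv0, div_eq_mul_inv, mul_inv]
        simp only [norm_mul, norm_pow, hv, mul_pow]
        ring
    _ ≤ _ := by gcongr

/-- Cancelling `(ABFv;Q)_∞` against the lower parameter of the series requires `(ABFv;Q)_k ≠ 0`. The
angles excluded in this way form a null set, which no integral sees. -/
theorem countable_setOf_mul_pow_eq_one (hr : 0 < r) (X Q : ℂ) :
    {θ : ℝ | ∃ k : ℕ, X * circleMap 0 r θ * Q ^ k = 1}.Countable := by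
  have h : (Set.range fun k : ℕ => (X * Q ^ k)⁻¹).Countable := Set.countable_range _
  refine (h.preimage_circleMap 0 hr.ne').mono ?_
  rintro θ ⟨k, hk⟩
  refine ⟨k, ?_⟩
  have h0 : X * Q ^ k * circleMap 0 r θ = 1 := by rw [← hk]; ring
  exact inv_eq_of_mul_eq_one_right h0

/-- The integrand of the integral representation on the circle of radius `r`. -/
noncomputable def arIntegrand (Q C D A B F ρ ρ' c y v : ℂ) : ℂ :=
  arWeight Q C D A B F ρ ρ' v * (qPochInf (A * B * F * v) Q *
    qHyp [A * B, A * F, c / v] [A * c, A * B * F * v] Q (y * v))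

theorem hasSum_arIntegrand (hr : 0 < r) (hQ1 : ‖Q‖ < 1) (hy : ‖y‖ * r < 1) {θ : ℝ}
    (hθ : ¬ ∃ k : ℕ, A * B * F * circleMap 0 r θ * Q ^ k = 1) :
    HasSum (fun k => arWeight Q C D A B F ρ ρ' (circleMap 0 r θ) *
        arTerm Q A B F c y (circleMap 0 r θ) k)
      (arIntegrand Q C D A B F ρ ρ' c y (circleMap 0 r θ)) := by
  have hn : ‖circleMap 0 r θ‖ = r := by simp [abs_of_pos hr]
  have hv0 : circleMap 0 r θ ≠ 0 := norm_pos_iff.1 (by rw [hn]; exact hr)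
  have hs := (summable_norm_qHypTerm (A := [A * B, A * F, c / circleMap 0 r θ])
    (B := [A * c, A * B * F * circleMap 0 r θ]) (q := Q) (z := y * circleMap 0 r θ) rfl hQ1
    (norm_mul_lt_one hy hn.le)).of_norm.hasSum
  have h2 := (hs.mul_left (qPochInf (A * B * F * circleMap 0 r θ) Q)).mul_left
    (arWeight Q C D A B F ρ ρ' (circleMap 0 r θ))
  push Not at hθ
  simp only [qPochInf_mul_qHypTerm hQ1 hv0 _ (qPoch_ne_zero fun k _ => hθ k)] at h2
  exact h2

theorem ae_not_mul_pow_eq_one (hr : 0 < r) (X Q : ℂ) :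
    ∀ᵐ θ : ℝ, ¬ ∃ k : ℕ, X * circleMap 0 r θ * Q ^ k = 1 := by
  have := (countable_setOf_mul_pow_eq_one hr X Q).ae_notMem (volume : Measure ℝ)
  exact this

theorem continuous_arTerm (hQ1 : ‖Q‖ < 1) (k : ℕ) :
    Continuous fun v => arTerm Q A B F c y v k := by
  simp only [arTerm, shiftProd]
  exact continuous_const.mul (Continuous.mul (by fun_prop)
    ((continuous_qPochInf hQ1).comp (by fun_prop)))

theorem intervalIntegrable_arIntegrand (hr : 0 < r) (hQ1 : ‖Q‖ < 1) (hC : ‖C‖ < r)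
    (hD : ‖D‖ < r) (hA : ‖A‖ * r < 1) (hB : ‖B‖ * r < 1) (hF : ‖F‖ * r < 1) (hy : ‖y‖ * r < 1)
    (a b : ℝ) :
    IntervalIntegrable (fun θ => arIntegrand Q C D A B F ρ ρ' c y (circleMap 0 r θ)) volume a b := by
  obtain ⟨K, hK⟩ := exists_norm_arTerm_le hr hQ1 A B F c y
  -- The series after cancellation is continuous on the whole circle and agrees almost everywhere
  -- with the integrand's product of `(ABFv;Q)_∞` and `₃φ₂`.
  have hc : Continuous fun θ : ℝ => ∑' k, arTerm Q A B F c y (circleMap 0 r θ) k := by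
    refine continuous_tsum (fun k => (continuous_arTerm hQ1 k).comp (continuous_circleMap 0 r))
      ((summable_geometric_of_lt_one (by positivity) hy).mul_left K) fun k θ => ?_
    exact hK k _ (by simp [abs_of_pos hr])
  have hw := continuous_arWeight (ρ := ρ) (ρ' := ρ') hr hQ1 hC hD hA hB hF
  refine ((hw.mul hc).intervalIntegrable a b).congr_ae ?_
  refine ae_restrict_of_ae ?_
  filter_upwards [ae_not_mul_pow_eq_one hr (A * B * F) Q] with θ hθ
  rw [Pi.mul_apply, ← tsum_mul_left]
  exact (hasSum_arIntegrand hr hQ1 hy hθ).tsum_eq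

theorem integral_arIntegrand (hr : 0 < r) (hQ0 : Q ≠ 0) (hQ1 : ‖Q‖ < 1) (hC : ‖C‖ < r)
    (hD : ‖D‖ < r) (hA : ‖A‖ * r < 1) (hB : ‖B‖ * r < 1) (hF : ‖F‖ * r < 1) (hCD : C * D = 1)
    (hρ : ρ * ρ' = Q) (hAc : ‖A * c‖ < 1) {z : ℂ} (hz : ‖z‖ < 1) (hz' : ‖C ^ 2 * z‖ < 1)
    (hy : ‖C * z‖ * r < 1) :
    ∫ θ in (-π)..π, arIntegrand Q C D A B F ρ ρ' c (C * z) (circleMap 0 r θ) =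
      2 * (π : ℂ) * arValue Q C D A B F ρ ρ' *
        (qHyp [A * C, c * C] [A * c] Q z * qHyp [B * D, F * D] [B * F] Q (C ^ 2 * z)) := by
  obtain ⟨K, hK⟩ := exists_norm_arTerm_le hr hQ1 A B F c (C * z)
  have hw := continuous_arWeight (ρ := ρ) (ρ' := ρ') hr hQ1 hC hD hA hB hF
  have hgeo := (summable_geometric_of_lt_one (by positivity) hy).mul_left K
  have h := intervalIntegral.hasSum_integral_of_dominated_convergence (μ := volume) (a := -π) (b := π)
    (F := fun k θ => arWeight Q C D A B F ρ ρ' (circleMap 0 r θ) *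
      arTerm Q A B F c (C * z) (circleMap 0 r θ) k)
    (f := fun θ => arIntegrand Q C D A B F ρ ρ' c (C * z) (circleMap 0 r θ))
    (fun k θ => ‖arWeight Q C D A B F ρ ρ' (circleMap 0 r θ)‖ * (K * (‖C * z‖ * r) ^ k))
    (fun k => (hw.mul ((continuous_arTerm hQ1 k).comp
      (continuous_circleMap 0 r))).aestronglyMeasurable)
    (fun k => .of_forall fun θ _ => ?_) (.of_forall fun θ _ => hgeo.mul_left _) ?_ ?_
  · refine h.unique ?_
    rw [qHyp, qHyp, tsum_mul_tsum_eq_tsum_sum_antidiagonal_of_summable_norm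
      (summable_norm_qHypTerm rfl hQ1 hz) (summable_norm_qHypTerm rfl hQ1 hz')]
    have hsum := (summable_norm_sum_mul_antidiagonal_of_summable_norm
      (summable_norm_qHypTerm (A := [A * C, c * C]) (B := [A * c]) rfl hQ1 hz)
      (summable_norm_qHypTerm (A := [B * D, F * D]) (B := [B * F]) rfl hQ1 hz')).of_norm.hasSum
    have h3 := hsum.mul_left (2 * (π : ℂ) * arValue Q C D A B F ρ ρ')
    refine h3.congr_fun fun k => ?_
    rw [integral_comp_circleMap (fun v => arWeight Q C D A B F ρ ρ' v *
      arTerm Q A B F c (C * z) v k) r, circleAverage_arTerm hr hQ0 hQ1 hC hD hA hB hF hCD hρ hAc,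
      mul_assoc, mul_assoc, mul_assoc]
  · rw [norm_mul]
    gcongr
    exact hK k _ (by simp [abs_of_pos hr])
  · simp only [tsum_mul_left]
    exact (hw.norm.mul continuous_const).intervalIntegrable _ _
  · filter_upwards [ae_not_mul_pow_eq_one hr (A * B * F) Q] with θ hθ _
    exact hasSum_arIntegrand hr hQ1 hy hθ

end

/-! ### The product of two series as a single series -/

section

open PowerSeries Finset.HasAntidiagonal

variable {q A B : ℂ}

theorem qPoch_mul_qPoch_neg (t q : ℂ) (n : ℕ) :
    qPoch t q n * qPoch (-t) q n = qPoch (t ^ 2) (q ^ 2) n := by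
  simp only [qPoch, ← Finset.prod_mul_distrib]
  exact Finset.prod_congr rfl fun k _ => by ring

/-- A first order recurrence for coefficients as a `q`-difference equation of the generating
function. -/
theorem qDifference_iff (Q s t a b : ℂ) (F : PowerSeries ℂ) :
    (F - C (1 + s) * rescale Q F + C s * rescale Q (rescale Q F) =
        X * (C t * (F - C (a + b) * rescale Q F + C (a * b) * rescale Q (rescale Q F)))) ↔
      ∀ n, coeff (n + 1) F * ((1 - Q ^ (n + 1)) * (1 - s * Q ^ (n + 1))) =
        t * ((1 - a * Q ^ n) * (1 - b * Q ^ n)) * coeff n F := by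
  rw [PowerSeries.ext_iff]
  constructor
  · intro h n
    have := h (n + 1)
    simp only [coeff_succ_X_mul, LinearMap.map_add, LinearMap.map_sub, coeff_C_mul, coeff_rescale] at this
    linear_combination this
  · intro h n
    cases n with
    -- No condition arises from the constant term, because `1 - (1 + s) + s = 0`.
    | zero =>
      simp only [coeff_zero_X_mul, LinearMap.map_add, LinearMap.map_sub, coeff_C_mul, coeff_rescale]
      ring
    | succ n =>
      simp only [coeff_succ_X_mul, LinearMap.map_add, LinearMap.map_sub, coeff_C_mul, coeff_rescale]
      linear_combination h n

/-- The coefficients of `₂φ₁(a, b; c; Q, tz)`. -/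
noncomputable def phiCoeff (a b c Q t : ℂ) (n : ℕ) : ℂ :=
  qPoch a Q n * qPoch b Q n / (qPoch Q Q n * qPoch c Q n) * t ^ n

theorem phiCoeff_succ {a b c Q t : ℂ} {n : ℕ} (hQ : qPoch Q Q (n + 1) ≠ 0)
    (hc : qPoch c Q (n + 1) ≠ 0) :
    phiCoeff a b c Q t (n + 1) * ((1 - Q ^ (n + 1)) * (1 - c * Q ^ n)) =
      t * ((1 - a * Q ^ n) * (1 - b * Q ^ n)) * phiCoeff a b c Q t n := by
  simp only [phiCoeff, qPoch_succ] at *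
  have h1 := left_ne_zero_of_mul hQ
  have h2 := right_ne_zero_of_mul hQ
  have h3 := left_ne_zero_of_mul hc
  have h4 := right_ne_zero_of_mul hc
  rw [show 1 - Q ^ (n + 1) = 1 - Q * Q ^ n by ring]
  generalize 1 - Q * Q ^ n = y1 at *
  generalize 1 - c * Q ^ n = y2 at *
  field_simp
  ring

theorem phiCoeff_zero (a b c Q t : ℂ) : phiCoeff a b c Q t 0 = 1 := by
  simp [phiCoeff, qPoch_zero]

/-- Euler's transformation of `₂φ₁(qA, qB; qAB; q², z)` as an identity of formal power series. -/
theorem mk_phiCoeff_mul (hq : q ≠ 0) (hQ : ∀ n, qPoch (q ^ 2) (q ^ 2) n ≠ 0)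
    (hx : ∀ n, qPoch (q * (A * B)) (q ^ 2) n ≠ 0) :
    PowerSeries.mk (phiCoeff (q * A) (q * B) (q * (A * B)) (q ^ 2) 1) *
        PowerSeries.mk (phiCoeff (1 / q) 0 0 (q ^ 2) q) =
      PowerSeries.mk (phiCoeff A B (q * (A * B)) (q ^ 2) q) := by
  set f := PowerSeries.mk (phiCoeff (q * A) (q * B) (q * (A * B)) (q ^ 2) 1) with hf
  set e := PowerSeries.mk (phiCoeff (1 / q) 0 0 (q ^ 2) q) with he
  have hs : ∀ n : ℕ, A * B / q * (q ^ 2) ^ (n + 1) = q * (A * B) * (q ^ 2) ^ n := fun n => by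
    rw [pow_succ]
    field_simp
  have e0 : ∀ n, qPoch 0 (q ^ 2) n ≠ 0 := fun n => by simp [qPoch]
  have hfe := (qDifference_iff (q ^ 2) (A * B / q) 1 (q * A) (q * B) f).2 fun n => by
    rw [hs, hf, coeff_mk, coeff_mk]
    exact phiCoeff_succ (hQ _) (hx _)
  have hee := (qDifference_iff (q ^ 2) 0 q (1 / q) 0 e).2 fun n => by
    rw [he, coeff_mk, coeff_mk, zero_mul, zero_mul]
    simpa using phiCoeff_succ (a := 1 / q) (b := 0) (c := 0) (t := q) (hQ _) (e0 (n + 1))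
  -- The product satisfies the difference equation of the right side, and the resulting recurrence
  -- with constant term `1` determines all coefficients.
  have hfg := (qDifference_iff (q ^ 2) (A * B / q) q A B (f * e)).1 ?_
  · ext n
    induction n with
    | zero =>
      rw [coeff_mul]
      simp [hf, he, phiCoeff_zero]
    | succ n ih =>
      have h1 := hfg n
      have h2 := phiCoeff_succ (a := A) (b := B) (t := q) (hQ (n + 1)) (hx (n + 1))
      rw [ih, coeff_mk, hs, ← h2] at h1
      have n1 := hQ (n + 1)
      have n2 := hx (n + 1)
      rw [qPoch_succ] at n1 n2
      have n3 := right_ne_zero_of_mul n1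
      have n4 := right_ne_zero_of_mul n2
      rw [← pow_succ'] at n3
      rw [coeff_mk]
      exact mul_right_cancel₀ (mul_ne_zero n3 n4) h1
  · have hc1 : (C (q * A + q * B) : PowerSeries ℂ) = C q * C (A + B) := by rw [← map_mul]; ring_nf
    have hc2 : (C (q * A * (q * B)) : PowerSeries ℂ) = C q ^ 3 * C (A * B / q) := by
      rw [← map_pow, ← map_mul]
      congr 1
      field_simp
    have hc3 : (C (A * B) : PowerSeries ℂ) = C q * C (A * B / q) := by
      rw [← map_mul]
      congr 1
      field_simp
    have hc4 : (C q * C (1 / q + 0) : PowerSeries ℂ) = 1 := by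
      rw [← map_mul, add_zero, mul_one_div_cancel hq, map_one]
    rw [hc1, hc2] at hfe
    -- By the `q`-binomial theorem `e` is `(z;q²)_∞/(qz;q²)_∞`; only its first order equation is
    -- needed.
    have hee' : (1 - C q * X) * e = (1 - X) * rescale (q ^ 2) e := by
      simp only [mul_zero, map_zero, add_zero, map_one, one_mul, zero_mul] at hee hc4
      linear_combination hee - X * rescale (q ^ 2) e * hc4
    have hRC : ∀ c : ℂ, rescale (q ^ 2) (C c : PowerSeries ℂ) = C c := fun c => by
      ext n
      rw [coeff_rescale, coeff_C]
      split_ifs with h <;> simp [h]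
    have hRee := congrArg (rescale (q ^ 2)) hee'
    simp only [map_mul, map_sub, map_one, rescale_X, hRC, map_pow] at hRee
    rw [hc3]
    simp only [map_mul, map_add, map_one] at hfe ⊢
    linear_combination f * hee' - C (A * B / q) * rescale (q ^ 2) (rescale (q ^ 2) f) * hRee +
      rescale (q ^ 2) e * hfe

/-- The recurrence of the symmetrized convolution sums. -/
theorem sum_phiCoeff_symm_succ (hq : q ≠ 0) (hQ : ∀ n, qPoch (q ^ 2) (q ^ 2) n ≠ 0)
    (hx : ∀ n, qPoch (q * (A * B)) (q ^ 2) n ≠ 0) (k : ℕ) :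
    (1 - q * q ^ k) * (1 - A * B * q ^ k) * (1 - q * (A * B) * q ^ (2 * k)) *
        ∑ p ∈ antidiagonal (k + 1), phiCoeff A B (q * (A * B)) (q ^ 2) 1 p.1 *
          phiCoeff A B (q * (A * B)) (q ^ 2) 1 p.2 * (q ^ p.1 + q ^ p.2) =
      (1 - A * q ^ k) * (1 - B * q ^ k) * (1 - A * B * q ^ (2 * k)) *
        ∑ p ∈ antidiagonal k, phiCoeff A B (q * (A * B)) (q ^ 2) 1 p.1 *
          phiCoeff A B (q * (A * B)) (q ^ 2) 1 p.2 * (q ^ p.1 + q ^ p.2) := by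
  set W := phiCoeff A B (q * (A * B)) (q ^ 2) 1 with hW
  have hWs : ∀ n, W (n + 1) = (1 - A * (q ^ 2) ^ n) * (1 - B * (q ^ 2) ^ n) * W n /
      ((1 - (q ^ 2) ^ (n + 1)) * (1 - q * (A * B) * (q ^ 2) ^ n)) ∧
      (1 - (q ^ 2) ^ (n + 1)) * (1 - q * (A * B) * (q ^ 2) ^ n) ≠ 0 := fun n => by
    have h2 := phiCoeff_succ (a := A) (b := B) (t := 1) (hQ (n + 1)) (hx (n + 1))
    have n1 := hQ (n + 1)
    have n2 := hx (n + 1)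
    rw [qPoch_succ] at n1 n2
    have n3 := right_ne_zero_of_mul n1
    have n4 := right_ne_zero_of_mul n2
    rw [← pow_succ'] at n3
    rw [one_mul] at h2
    exact ⟨by rw [eq_div_iff (mul_ne_zero n3 n4), hW, h2], mul_ne_zero n3 n4⟩
  -- A telescoping certificate. The factor `(1-q^{2j})(1-ABq^{2j-1})` is the denominator of
  -- `W_j/W_{j-1}`, so `H(j+1,i)` is a multiple of `W_j W_i`, and `H` vanishes at `j = 0`.
  set H : ℕ × ℕ → ℂ := fun p => (-q ^ p.2 + A * B * q ^ k * q ^ (3 * p.2)) *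
    (W p.1 * ((1 - q ^ (2 * p.1)) * (1 - A * B * q ^ (2 * p.1) / q))) * W p.2 with hH
  have hstep : ∀ p ∈ antidiagonal k,
      (1 - q * q ^ k) * (1 - A * B * q ^ k) * (1 - q * (A * B) * q ^ (2 * k)) *
        (W p.1 * W (p.2 + 1) * (q ^ p.1 + q ^ (p.2 + 1))) =
      (1 - A * q ^ k) * (1 - B * q ^ k) * (1 - A * B * q ^ (2 * k)) *
        (W p.1 * W p.2 * (q ^ p.1 + q ^ p.2)) + (H (p.1 + 1, p.2) - H (p.1, p.2 + 1)) := by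
    rintro ⟨j, i⟩ hp
    have hk := mem_antidiagonal.1 hp
    simp only at hk
    subst hk
    obtain ⟨h1, n1⟩ := hWs i
    obtain ⟨h2, n2⟩ := hWs j
    have g1 : W (j + 1) * ((1 - q ^ (2 * (j + 1))) * (1 - A * B * q ^ (2 * (j + 1)) / q)) =
        (1 - A * (q ^ 2) ^ j) * (1 - B * (q ^ 2) ^ j) * W j := by
      have e1 : A * B * q ^ (2 * (j + 1)) / q = q * (A * B) * (q ^ 2) ^ j := by
        rw [pow_mul, pow_succ]
        field_simp
      rw [e1, pow_mul q 2, h2, div_mul_cancel₀ _ n2]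
    simp only [hH]
    rw [g1]
    have eQ : ∀ n : ℕ, (q ^ 2) ^ n = (q ^ n) ^ 2 := fun n => by rw [← pow_mul, ← pow_mul, mul_comm]
    have e3 : q ^ (3 * i) = (q ^ i) ^ 3 := by rw [← pow_mul, mul_comm]
    have e4 : q ^ (3 * (i + 1)) = (q * q ^ i) ^ 3 := by rw [← pow_succ', ← pow_mul, mul_comm]
    have e5 : q ^ (2 * (j + i)) = (q ^ j * q ^ i) ^ 2 := by rw [← pow_add, ← pow_mul, mul_comm]
    have e6 : q ^ (2 * j) = (q ^ j) ^ 2 := by rw [← pow_mul, mul_comm]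
    rw [e3, e4, e5, e6, pow_add q j i, eQ, pow_succ' q i]
    rw [eq_div_iff n1] at h1
    rw [eQ, eQ, pow_succ' q i] at n1 h1
    generalize q ^ i = Z at *
    generalize q ^ j = Y at *
    generalize W (i + 1) = w0 at *
    generalize W i = w1 at *
    generalize W j = w2 at *
    have key : ((1 - q * (Y * Z)) * (1 - A * B * (Y * Z)) * (1 - q * (A * B) * (Y * Z) ^ 2) *
        (Y + q * Z) + (-(q * Z) + A * B * (Y * Z) * (q * Z) ^ 3) *
          ((1 - Y ^ 2) * (1 - A * B * Y ^ 2 / q))) * ((1 - A * Z ^ 2) * (1 - B * Z ^ 2)) =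
        (1 - (q * Z) ^ 2) * (1 - q * (A * B) * Z ^ 2) *
        ((1 - A * (Y * Z)) * (1 - B * (Y * Z)) * (1 - A * B * (Y * Z) ^ 2) * (Y + Z) +
          (-Z + A * B * (Y * Z) * Z ^ 3) * ((1 - A * Y ^ 2) * (1 - B * Y ^ 2))) := by
      field_simp
      ring
    refine mul_left_cancel₀ n1 ?_
    linear_combination ((1 - q * (Y * Z)) * (1 - A * B * (Y * Z)) *
      (1 - q * (A * B) * (Y * Z) ^ 2) * (Y + q * Z) + (-(q * Z) + A * B * (Y * Z) * (q * Z) ^ 3) *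
        ((1 - Y ^ 2) * (1 - A * B * Y ^ 2 / q))) * w2 * h1 + w1 * w2 * key
  have hsum := Finset.sum_congr rfl hstep
  rw [Finset.sum_add_distrib, Finset.sum_sub_distrib, ← Finset.mul_sum, ← Finset.mul_sum] at hsum
  have t1 := Finset.Nat.sum_antidiagonal_succ (n := k) (f := H)
  have t2 := Finset.Nat.sum_antidiagonal_succ' (n := k) (f := H)
  have hH0 : H (0, k + 1) = 0 := by simp [hH]
  -- The surviving boundary value is minus the term `(k+1, 0)`, the one that summing over `(j, i+1)`
  -- leaves out.
  have hHk : H (k + 1, 0) = -((1 - q * q ^ k) * (1 - A * B * q ^ k) *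
      (1 - q * (A * B) * q ^ (2 * k)) * (W (k + 1) * W 0 * (q ^ (k + 1) + q ^ 0))) := by
    simp only [hH]
    have e1 : A * B * q ^ (2 * (k + 1)) / q = q * (A * B) * q ^ (2 * k) := by
      rw [mul_add, pow_add]
      field_simp
    rw [e1]
    ring
  clear_value H W
  rw [Finset.Nat.sum_antidiagonal_succ', mul_add]
  linear_combination hsum + t2 - t1 - hH0 + hHk

theorem sum_phiCoeff_symm (hq : q ≠ 0) (hq1 : ∀ n, qPoch q q n ≠ 0)
    (hQ : ∀ n, qPoch (q ^ 2) (q ^ 2) n ≠ 0) (hx : ∀ n, qPoch (q * (A * B)) (q ^ 2) n ≠ 0)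
    (hx' : ∀ n, qPoch (A * B / q) q n ≠ 0) (k : ℕ) :
    (1 - A * B / q * q ^ k) * ∑ p ∈ antidiagonal k, phiCoeff A B (q * (A * B)) (q ^ 2) 1 p.1 *
          phiCoeff A B (q * (A * B)) (q ^ 2) 1 p.2 * (q ^ p.1 + q ^ p.2) =
      2 * (1 - A * B / q) * (qPoch A q k * qPoch B q k * qPoch (A * B) (q ^ 2) k /
        (qPoch q q k * qPoch (A * B / q) q k * qPoch (q * (A * B)) (q ^ 2) k)) := by
  induction k with
  | zero =>
    simp [phiCoeff_zero, qPoch_zero]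
    ring
  | succ k ih =>
    have h := sum_phiCoeff_symm_succ (A := A) (B := B) hq hQ hx k
    have n1 := hq1 (k + 1)
    have n2 := hx (k + 1)
    have n3 := hx' (k + 1)
    -- One index further than the statement for `k + 1` shows: the last factor here is `1 - ABq^k`.
    have n4 := hx' (k + 2)
    rw [qPoch_succ] at n4
    replace n4 := right_ne_zero_of_mul n4
    have e1 : A * B / q * q ^ (k + 1) = A * B * q ^ k := by rw [pow_succ]; field_simp
    have e2 : (q ^ 2) ^ k = q ^ (2 * k) := (pow_mul q 2 k).symm
    rw [e1] at n4 ⊢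
    simp only [qPoch_succ, e2] at *
    have a1 := left_ne_zero_of_mul n1
    have a2 := right_ne_zero_of_mul n1
    have b1 := left_ne_zero_of_mul n2
    have b2 := right_ne_zero_of_mul n2
    have c1 := left_ne_zero_of_mul n3
    have c2 := right_ne_zero_of_mul n3
    generalize (∑ p ∈ antidiagonal (k + 1), phiCoeff A B (q * (A * B)) (q ^ 2) 1 p.1 *
          phiCoeff A B (q * (A * B)) (q ^ 2) 1 p.2 * (q ^ p.1 + q ^ p.2)) = S' at *
    generalize (∑ p ∈ antidiagonal k, phiCoeff A B (q * (A * B)) (q ^ 2) 1 p.1 *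
          phiCoeff A B (q * (A * B)) (q ^ 2) 1 p.2 * (q ^ p.1 + q ^ p.2)) = S at *
    generalize 1 - A * B / q = t at *
    generalize 1 - A * B / q * q ^ k = s1 at *
    generalize 1 - A * B * q ^ k = s2 at *
    generalize 1 - q * q ^ k = s3 at *
    generalize 1 - q * (A * B) * q ^ (2 * k) = s4 at *
    generalize 1 - A * q ^ k = s5 at *
    generalize 1 - B * q ^ k = s6 at *
    generalize 1 - A * B * q ^ (2 * k) = s7 at *
    generalize qPoch A q k = y1 at *
    generalize qPoch B q k = y2 at *
    generalize qPoch (A * B) (q ^ 2) k = y3 at *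
    generalize qPoch q q k = y4 at *
    generalize qPoch (A * B / q) q k = y5 at *
    generalize qPoch (q * (A * B)) (q ^ 2) k = y6 at *
    have hS : S = 2 * t * (y1 * y2 * y3 / (y4 * y5 * y6)) / s1 := by
      rw [eq_div_iff c2, mul_comm, ih]
    rw [hS] at h
    have hS' : s2 * S' = s5 * s6 * s7 * (2 * t * (y1 * y2 * y3 / (y4 * y5 * y6)) / s1) /
        (s3 * s4) := by
      rw [eq_div_iff (mul_ne_zero a2 b2), ← h]
      ring
    rw [hS']
    field_simp

theorem qPoch_div_mul (hq : q ≠ 0) (x : ℂ) (n : ℕ) :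
    qPoch (x / q) (q ^ 2) n * (1 - x / q * (q ^ 2) ^ n) =
      (1 - x / q) * qPoch (q * x) (q ^ 2) n := by
  rw [← qPoch_succ, qPoch_succ', show x / q * q ^ 2 = q * x by field_simp]

/-- The convolution of the coefficients of the two series has a closed form. -/
theorem sum_phiCoeff_mul_phiCoeff (hq : q ≠ 0) (hq1 : ∀ n, qPoch q q n ≠ 0)
    (hQ : ∀ n, qPoch (q ^ 2) (q ^ 2) n ≠ 0) (hx : ∀ n, qPoch (q * (A * B)) (q ^ 2) n ≠ 0)
    (hxq : ∀ n, qPoch (A * B / q) (q ^ 2) n ≠ 0)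
    (hx' : ∀ n, qPoch (A * B / q) q n ≠ 0) (k : ℕ) :
    ∑ p ∈ antidiagonal k, phiCoeff (q * A) (q * B) (q * (A * B)) (q ^ 2) 1 p.1 *
        phiCoeff (A / q) (B / q) (A * B / q) (q ^ 2) q p.2 =
      qPoch A q k * qPoch B q k * qPoch (A * B) (q ^ 2) k /
        (qPoch q q k * qPoch (A * B / q) q k * qPoch (q * (A * B)) (q ^ 2) k) := by
  have E1 := mk_phiCoeff_mul (A := A) (B := B) hq hQ hx
  have ex : q * (A / q * (B / q)) = A * B / q := by field_simp
  -- The same transformation at `A/q`, `B/q` has the same multiplier, which can thus be moved from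
  -- one series of the product to the other.
  have E2 := mk_phiCoeff_mul (A := A / q) (B := B / q) hq hQ (by rw [ex]; exact hxq)
  rw [ex, mul_div_cancel₀ _ hq, mul_div_cancel₀ _ hq] at E2
  have E3 := congrArg (coeff k) (show
    PowerSeries.mk (phiCoeff (q * A) (q * B) (q * (A * B)) (q ^ 2) 1) *
      PowerSeries.mk (phiCoeff (A / q) (B / q) (A * B / q) (q ^ 2) q) =
    PowerSeries.mk (phiCoeff A B (A * B / q) (q ^ 2) 1) *
      PowerSeries.mk (phiCoeff A B (q * (A * B)) (q ^ 2) q) by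
    rw [← E1, ← E2]; ring)
  rw [coeff_mul, coeff_mul] at E3
  simp only [coeff_mk] at E3
  rw [E3]
  set W := phiCoeff A B (q * (A * B)) (q ^ 2) 1 with hW
  have t0 : 1 - A * B / q ≠ 0 := by
    have := hx' 1
    simpa [qPoch] using this
  have h1 : ∀ p ∈ antidiagonal k, phiCoeff A B (A * B / q) (q ^ 2) 1 p.1 *
      phiCoeff A B (q * (A * B)) (q ^ 2) q p.2 =
      (W p.1 * W p.2 * ((1 - A * B / q * q ^ (2 * p.1)) * q ^ p.2)) / (1 - A * B / q) := by
    rintro ⟨j, i⟩ -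
    have hd := qPoch_div_mul hq (A * B) j
    have n1 := hx j
    have n2 := hxq j
    simp only [hW, phiCoeff, one_pow, mul_one, pow_mul]
    -- The lower parameters `AB/q` and `qAB` differ by the factor `q²`, so both series have
    -- coefficients expressible through `W`.
    have : 1 / qPoch (A * B / q) (q ^ 2) j =
        (1 - A * B / q * (q ^ 2) ^ j) / ((1 - A * B / q) * qPoch (q * (A * B)) (q ^ 2) j) := by
      rw [div_eq_div_iff n2 (mul_ne_zero t0 n1)]
      linear_combination -hd
    calc _ = qPoch A (q ^ 2) j * qPoch B (q ^ 2) j / qPoch (q ^ 2) (q ^ 2) j *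
          (1 / qPoch (A * B / q) (q ^ 2) j) * (qPoch A (q ^ 2) i * qPoch B (q ^ 2) i /
          (qPoch (q ^ 2) (q ^ 2) i * qPoch (q * (A * B)) (q ^ 2) i) * q ^ i) := by ring
      _ = _ := by
          rw [this]
          generalize 1 - A * B / q = t
          ring
  rw [Finset.sum_congr rfl h1, ← Finset.sum_div]
  have hsym : ∑ p ∈ antidiagonal k, W p.1 * W p.2 * ((1 - A * B / q * q ^ (2 * p.1)) * q ^ p.2) =
      ∑ p ∈ antidiagonal k, W p.1 * W p.2 * ((1 - A * B / q * q ^ (2 * p.2)) * q ^ p.1) := by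
    rw [← Finset.Nat.sum_antidiagonal_swap]
    exact Finset.sum_congr rfl fun p _ => by simp only [Prod.fst_swap, Prod.snd_swap]; ring
  -- With `x = AB/q`, the sum of `(1 - xq^{2j})q^i` and its mirror image is `(1 - xq^k)(q^i + q^j)`
  -- when `j + i = k`.
  have hadd : 2 * ∑ p ∈ antidiagonal k,
        W p.1 * W p.2 * ((1 - A * B / q * q ^ (2 * p.1)) * q ^ p.2) =
      (1 - A * B / q * q ^ k) * ∑ p ∈ antidiagonal k, W p.1 * W p.2 * (q ^ p.1 + q ^ p.2) := by
    rw [two_mul]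
    nth_rw 2 [hsym]
    rw [← Finset.sum_add_distrib, Finset.mul_sum]
    refine Finset.sum_congr rfl ?_
    rintro ⟨j, i⟩ hp
    have hk := mem_antidiagonal.1 hp
    simp only at hk
    subst hk
    ring
  rw [sum_phiCoeff_symm hq hq1 hQ hx hx'] at hadd
  rw [div_eq_iff t0]
  linear_combination hadd / 2

end

/-! ### The main theorem -/

theorem qHypTerm_eq_phiCoeff (a b c Q t z : ℂ) (n : ℕ) :
    qHypTerm [a, b] [c] Q (t * z) n = phiCoeff a b c Q t n * z ^ n := by
  rw [qHypTerm_balanced rfl, phiCoeff]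
  simp only [qPochList, List.map_cons, List.map_nil, List.prod_cons, List.prod_nil, mul_one]
  ring

theorem mul_pow_ne_one_of_notMem_qOmega {x q : ℂ} (h : x ∉ qOmega q) (k : ℕ) :
    x * q ^ k ≠ 1 :=
  fun hk => h ⟨k, (eq_inv_of_mul_eq_one_left hk)⟩

theorem qHyp_mul_qHyp {q h a b z : ℂ} (hq0 : q ≠ 0) (hq1 : ‖q‖ < 1) (hh : h ^ 2 = q)
    (hz : ‖z‖ < 1) (hab : a ^ 2 * b ^ 2 / q ∉ qOmega q) :
    qHyp [q * a ^ 2, q * b ^ 2] [q * a ^ 2 * b ^ 2] (q ^ 2) z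
        * qHyp [a ^ 2 / q, b ^ 2 / q] [a ^ 2 * b ^ 2 / q] (q ^ 2) (q * z)
      = qHyp [a ^ 2, b ^ 2, a * b, -(a * b)]
          [a ^ 2 * b ^ 2 / q, h * a * b, -(h * a * b)] q z := by
  have hQ1 : ‖q ^ 2‖ < 1 := by
    rw [norm_pow]
    exact pow_lt_one₀ (norm_nonneg _) hq1 two_ne_zero
  have hqz : ‖q * z‖ < 1 := by
    rw [norm_mul]
    nlinarith [norm_nonneg q, norm_nonneg z]
  have hne := mul_pow_ne_one_of_notMem_qOmega hab
  have hx' : ∀ n, qPoch (a ^ 2 * b ^ 2 / q) q n ≠ 0 := fun n => qPoch_ne_zero fun k _ => hne k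
  have hxq : ∀ n, qPoch (a ^ 2 * b ^ 2 / q) (q ^ 2) n ≠ 0 := fun n => qPoch_ne_zero fun k _ => by
    rw [← pow_mul]
    exact hne _
  have hx : ∀ n, qPoch (q * (a ^ 2 * b ^ 2)) (q ^ 2) n ≠ 0 := fun n => qPoch_ne_zero fun k _ => by
    have e : q * (a ^ 2 * b ^ 2) * (q ^ 2) ^ k = a ^ 2 * b ^ 2 / q * q ^ (2 * k + 2) := by
      rw [pow_add, pow_mul]
      field_simp
    rw [e]
    exact hne _
  rw [qHyp, qHyp, tsum_mul_tsum_eq_tsum_sum_antidiagonal_of_summable_norm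
    (summable_norm_qHypTerm rfl hQ1 hz) (summable_norm_qHypTerm rfl hQ1 hqz), qHyp]
  refine tsum_congr fun k => ?_
  have hs := sum_phiCoeff_mul_phiCoeff hq0 (qPoch_ne_zero_of_norm_lt_one hq1 hq1)
    (qPoch_ne_zero_of_norm_lt_one hQ1 hQ1) hx hxq hx' k
  calc _ = (∑ p ∈ Finset.HasAntidiagonal.antidiagonal k,
        phiCoeff (q * a ^ 2) (q * b ^ 2) (q * (a ^ 2 * b ^ 2)) (q ^ 2) 1 p.1 *
        phiCoeff (a ^ 2 / q) (b ^ 2 / q) (a ^ 2 * b ^ 2 / q) (q ^ 2) q p.2) * z ^ k := by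
        rw [Finset.sum_mul]
        refine Finset.sum_congr rfl fun p hp => ?_
        have h1 := qHypTerm_eq_phiCoeff (q * a ^ 2) (q * b ^ 2) (q * a ^ 2 * b ^ 2) (q ^ 2) 1 z p.1
        rw [one_mul] at h1
        rw [h1, qHypTerm_eq_phiCoeff, mul_assoc q, ← Finset.HasAntidiagonal.mem_antidiagonal.1 hp,
          pow_add]
        ring
    _ = _ := by
        rw [hs, qHypTerm_balanced rfl]
        simp only [qPochList, List.map_cons, List.map_nil, List.prod_cons, List.prod_nil, mul_one]
        -- The pairs `±ab` and `±q^{1/2}ab` in base `q` merge into `a²b²` and `qa²b²` in base `q²`.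
        rw [qPoch_mul_qPoch_neg, qPoch_mul_qPoch_neg,
          show (h * a * b) ^ 2 = q * (a ^ 2 * b ^ 2) by rw [← hh]; ring,
          show (a * b) ^ 2 = a ^ 2 * b ^ 2 by ring]
        ring

/-- The specialization that links the general integral to the theorem: `v = w/σ` on the circle of
radius `1/σ`, poles `C = q^{1/2}`, `D = q^{-1/2}` with `CD = 1`, and `ρρ' = q²`, which makes the
factors with `f` a pair of theta functions. -/
theorem prodIntegrand_eq {q h a b z f : ℂ} {σ : ℝ} (hh : h ^ 2 = q) (h0 : h ≠ 0)
    (hσ : 0 < σ) (ψ : ℝ) :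
    prodIntegrand q h a b z f σ ψ =
      arIntegrand (q ^ 2) h h⁻¹ (h * a ^ 2) (h⁻¹ * a ^ 2) (h⁻¹ * b ^ 2) (h * f) (h ^ 3 / f)
        (h * b ^ 2) (h * z) (circleMap 0 σ⁻¹ ψ) := by
  have hσ' : (σ : ℂ) ≠ 0 := by exact_mod_cast hσ.ne'
  have hv : Complex.exp (Complex.I * (ψ : ℂ)) / (σ : ℂ) = circleMap 0 σ⁻¹ ψ := by
    rw [circleMap_zero, mul_comm Complex.I]
    push_cast
    ring
  have hu : (σ : ℂ) / Complex.exp (Complex.I * (ψ : ℂ)) = (circleMap 0 σ⁻¹ ψ)⁻¹ := by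
    rw [← hv, inv_div]
  simp only [prodIntegrand, hv, hu]
  generalize circleMap 0 σ⁻¹ ψ = v
  have e1 : h * a ^ 2 * (h⁻¹ * a ^ 2) = a ^ 4 := by field_simp
  have e2 : h * a ^ 2 * (h⁻¹ * b ^ 2) = a ^ 2 * b ^ 2 := by field_simp
  have e3 : h * a ^ 2 * (h * b ^ 2) = q * a ^ 2 * b ^ 2 := by rw [← hh]; ring
  simp only [arIntegrand, arWeight, thetaPair, upper32, lower32, e1, e2, e3]
  rw [show a ^ 4 * (h⁻¹ * b ^ 2) * v = h⁻¹ * a ^ 4 * b ^ 2 * v by ring]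
  simp only [qPochInfList, List.map_cons, List.map_nil, List.prod_cons, List.prod_nil, mul_one,
    div_eq_mul_inv]
  ring

theorem norm_lt_of_inv {x : ℂ} {σ : ℝ} (hσ : 0 < σ) (h : ‖x‖ * σ < 1) : ‖x‖ < σ⁻¹ := by
  rwa [← one_div, lt_div_iff₀ hσ]

theorem prodPrefactor_mul_integral {q h a b z f : ℂ} {σ : ℝ} (hq0 : q ≠ 0) (hq1 : ‖q‖ < 1)
    (hh : h ^ 2 = q) (hz : ‖z‖ < 1) (hf0 : f ≠ 0) (hσ : 0 < σ) (hf : ∀ n : ℤ, f ≠ q ^ n)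
    (hC : ‖h‖ * σ < 1) (hD : ‖h⁻¹‖ * σ < 1) (hA : ‖h * a ^ 2‖ / σ < 1)
    (hB : ‖h⁻¹ * a ^ 2‖ / σ < 1) (hF : ‖h⁻¹ * b ^ 2‖ / σ < 1) (hy : ‖h * z‖ / σ < 1) :
    prodPrefactor q a b f * ∫ ψ in (-π)..π, prodIntegrand q h a b z f σ ψ =
      qHyp [q * a ^ 2, q * b ^ 2] [q * a ^ 2 * b ^ 2] (q ^ 2) z
          * qHyp [a ^ 2 / q, b ^ 2 / q] [a ^ 2 * b ^ 2 / q] (q ^ 2) (q * z) := by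
  have h0 : h ≠ 0 := by rintro rfl; exact hq0 (by rw [← hh]; simp)
  have hQ0 : q ^ 2 ≠ 0 := pow_ne_zero 2 hq0
  have hQ1 : ‖q ^ 2‖ < 1 := by
    rw [norm_pow]
    exact pow_lt_one₀ (norm_nonneg _) hq1 two_ne_zero
  have hqz : ‖h ^ 2 * z‖ < 1 := by
    rw [norm_mul, hh]
    nlinarith [norm_nonneg q, norm_nonneg z]
  have hr : 0 < σ⁻¹ := inv_pos.2 hσ
  rw [div_eq_mul_inv] at hA hB hF hy
  replace hC := norm_lt_of_inv hσ hC
  replace hD := norm_lt_of_inv hσ hD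
  have hCD : h * h⁻¹ = 1 := mul_inv_cancel₀ h0
  have hρ : h * f * (h ^ 3 / f) = q ^ 2 := by rw [← hh]; field_simp
  have nAC := norm_mul_lt_one_of_lt hA hC
  have nAD := norm_mul_lt_one_of_lt hA hD
  have nBC := norm_mul_lt_one_of_lt hB hC
  have nBD := norm_mul_lt_one_of_lt hB hD
  have nFC := norm_mul_lt_one_of_lt hF hC
  have nFD := norm_mul_lt_one_of_lt hF hD
  have nAB := norm_mul_lt_one_of_mul_eq_one hCD hC hD hA hB
  have nAF := norm_mul_lt_one_of_mul_eq_one hCD hC hD hA hF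
  have nBF := norm_mul_lt_one_of_mul_eq_one hCD hC hD hB hF
  -- The six products of `A`, `B`, `F` with `C`, `D` are the numerator parameters of the prefactor
  -- apart from `q²`; `AD` and `BC` coincide, hence the repeated `a²`.
  have eAC : h * a ^ 2 * h = q * a ^ 2 := by rw [← hh]; ring
  have eAD : h * a ^ 2 * h⁻¹ = a ^ 2 := by field_simp
  have eBC : h⁻¹ * a ^ 2 * h = a ^ 2 := by field_simp
  have eBD : h⁻¹ * a ^ 2 * h⁻¹ = a ^ 2 / q := by rw [← hh]; field_simp
  have eFC : h⁻¹ * b ^ 2 * h = b ^ 2 := by field_simp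
  have eFD : h⁻¹ * b ^ 2 * h⁻¹ = b ^ 2 / q := by rw [← hh]; field_simp
  have eAB : h * a ^ 2 * (h⁻¹ * a ^ 2) = a ^ 4 := by field_simp
  have eAF : h * a ^ 2 * (h⁻¹ * b ^ 2) = a ^ 2 * b ^ 2 := by field_simp
  have eBF : h⁻¹ * a ^ 2 * (h⁻¹ * b ^ 2) = a ^ 2 * b ^ 2 / q := by rw [← hh]; field_simp
  have eAc : h * a ^ 2 * (h * b ^ 2) = q * a ^ 2 * b ^ 2 := by rw [← hh]; ring
  have ecC : h * b ^ 2 * h = q * b ^ 2 := by rw [← hh]; ring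
  have nAc : ‖h * a ^ 2 * (h * b ^ 2)‖ < 1 := by
    rw [show h * a ^ 2 * (h * b ^ 2) = h * a ^ 2 * h * (h⁻¹ * b ^ 2 * h) by rw [eFC]; ring, norm_mul]
    nlinarith [norm_nonneg (h * a ^ 2 * h), norm_nonneg (h⁻¹ * b ^ 2 * h)]
  simp only [prodIntegrand_eq hh h0 hσ]
  rw [integral_arIntegrand hr hQ0 hQ1 hC hD hA hB hF hCD hρ nAc hz hqz hy]
  rw [eAC] at nAC
  rw [eAD] at nAD
  rw [eBD] at nBD
  rw [eFC] at nFC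
  rw [eFD] at nFD
  rw [eAB] at nAB
  rw [eAF] at nAF
  rw [eBF] at nBF
  simp only [arValue, eAC, eAD, eBC, eBD, eFC, eFD, eAB, eAF, eBF, eAc, ecC, hh]
  rw [show h * f * h = q * f by rw [← hh]; ring, show h * f * h⁻¹ = f by field_simp,
    show h ^ 3 / f * h = q ^ 2 / f by rw [← hh]; ring,
    show h ^ 3 / f * h⁻¹ = q / f by rw [← hh]; field_simp]
  -- The theta constants in the value of the integral have zeros exactly at integer powers of `q`,
  -- which `f` avoids, so they cancel against the prefactor.
  have nf : ∀ x : ℂ, (∀ k : ℕ, x * (q ^ 2) ^ k ≠ 1) → qPochInf x (q ^ 2) ≠ 0 := fun x hx =>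
    qPochInf_ne_zero hQ1 hx
  have n1 := nf f fun k hk => hf (-((2 * k : ℕ) : ℤ)) (by
    rw [← pow_mul] at hk
    rw [zpow_neg, zpow_natCast]
    exact eq_inv_of_mul_eq_one_left hk)
  have n2 := nf (q * f) fun k hk => hf (-((2 * k + 1 : ℕ) : ℤ)) (by
    rw [zpow_neg, zpow_natCast]
    refine eq_inv_of_mul_eq_one_left ?_
    rw [← hk]
    ring)
  have n3 := nf (q ^ 2 / f) fun k hk => hf ((2 * k + 2 : ℕ) : ℤ) (by
    rw [zpow_natCast]
    field_simp at hk
    rw [← hk]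
    ring)
  have n4 := nf (q / f) fun k hk => hf ((2 * k + 1 : ℕ) : ℤ) (by
    rw [zpow_natCast]
    field_simp at hk
    rw [← hk]
    ring)
  have mQ := qPochInf_ne_zero_of_norm_lt_one hQ1 hQ1
  have mAC := qPochInf_ne_zero_of_norm_lt_one hQ1 nAC
  have mAD := qPochInf_ne_zero_of_norm_lt_one hQ1 nAD
  have mBD := qPochInf_ne_zero_of_norm_lt_one hQ1 nBD
  have mFC := qPochInf_ne_zero_of_norm_lt_one hQ1 nFC
  have mFD := qPochInf_ne_zero_of_norm_lt_one hQ1 nFD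
  have mAB := qPochInf_ne_zero_of_norm_lt_one hQ1 nAB
  have mAF := qPochInf_ne_zero_of_norm_lt_one hQ1 nAF
  have mBF := qPochInf_ne_zero_of_norm_lt_one hQ1 nBF
  have hπ : (π : ℂ) ≠ 0 := by exact_mod_cast Real.pi_ne_zero
  simp only [prodPrefactor, qPochInfList, List.map_cons, List.map_nil, List.prod_cons,
    List.prod_nil, mul_one]
  generalize qPochInf f (q ^ 2) = x1 at *
  generalize qPochInf (q * f) (q ^ 2) = x2 at *
  generalize qPochInf (q ^ 2 / f) (q ^ 2) = x3 at *
  generalize qPochInf (q / f) (q ^ 2) = x4 at *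
  generalize qPochInf (q ^ 2) (q ^ 2) = x5 at *
  generalize qPochInf (q * a ^ 2) (q ^ 2) = x6 at *
  generalize qPochInf (a ^ 2) (q ^ 2) = x7 at *
  generalize qPochInf (a ^ 2 / q) (q ^ 2) = x8 at *
  generalize qPochInf (b ^ 2) (q ^ 2) = x9 at *
  generalize qPochInf (b ^ 2 / q) (q ^ 2) = x10 at *
  generalize qPochInf (a ^ 4) (q ^ 2) = x11 at *
  generalize qPochInf (a ^ 2 * b ^ 2) (q ^ 2) = x12 at *
  generalize qPochInf (a ^ 2 * b ^ 2 / q) (q ^ 2) = x13 at *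
  generalize qHyp [q * a ^ 2, q * b ^ 2] [q * a ^ 2 * b ^ 2] (q ^ 2) z = y1
  generalize qHyp [a ^ 2 / q, b ^ 2 / q] [a ^ 2 * b ^ 2 / q] (q ^ 2) (q * z) = y2
  field_simp

theorem mainTheorem12 (q h a b z : ℂ)
    (hq0 : 0 < ‖q‖) (hq1 : ‖q‖ < 1)
    -- `h` is a square root `q^{1/2}` of `q`
    (hh : h ^ 2 = q)
    (ha : a ≠ 0) (hb : b ≠ 0) (hz0 : z ≠ 0) (hz : ‖z‖ < 1)
    -- this implies that the other lower parameters are admissible too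
    (hab : a ^ 2 * b ^ 2 / q ∉ qOmega q) :
    -- the three series converge
    (Summable (qHypTerm [q * a ^ 2, q * b ^ 2] [q * a ^ 2 * b ^ 2] (q ^ 2) z) ∧
      Summable (qHypTerm [a ^ 2 / q, b ^ 2 / q] [a ^ 2 * b ^ 2 / q] (q ^ 2) (q * z)) ∧
      Summable (qHypTerm [a ^ 2, b ^ 2, a * b, -(a * b)]
        [a ^ 2 * b ^ 2 / q, h * a * b, -(h * a * b)] q z)) ∧
    -- the product formula
    qHyp [q * a ^ 2, q * b ^ 2] [q * a ^ 2 * b ^ 2] (q ^ 2) z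
        * qHyp [a ^ 2 / q, b ^ 2 / q] [a ^ 2 * b ^ 2 / q] (q ^ 2) (q * z)
      = qHyp [a ^ 2, b ^ 2, a * b, -(a * b)]
          [a ^ 2 * b ^ 2 / q, h * a * b, -(h * a * b)] q z ∧
    -- the integral representation
    (∀ (f : ℂ) (σ : ℝ), f ≠ 0 → 0 < σ →
      -- the factors depending on `f` in the denominator of the prefactor do not vanish
      (∀ n : ℤ, f ≠ q ^ n) →
      -- the denominator elements of the integrand have modulus less than one
      ‖h‖ * σ < 1 → ‖h⁻¹‖ * σ < 1 →
      ‖h * a ^ 2‖ / σ < 1 → ‖h⁻¹ * a ^ 2‖ / σ < 1 → ‖h⁻¹ * b ^ 2‖ / σ < 1 →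
      -- the argument of the `₃φ₂` has modulus less than one
      ‖h * z‖ / σ < 1 →
      (∀ ψ : ℝ, Summable (qHypTerm
        (upper32 h a b ((σ : ℂ) / Complex.exp (Complex.I * (ψ : ℂ))))
        (lower32 q h a b (Complex.exp (Complex.I * (ψ : ℂ)) / (σ : ℂ))) (q ^ 2)
        (h * z * (Complex.exp (Complex.I * (ψ : ℂ)) / (σ : ℂ))))) ∧
      IntervalIntegrable (prodIntegrand q h a b z f σ) volume (-π) π ∧
      qHyp [q * a ^ 2, q * b ^ 2] [q * a ^ 2 * b ^ 2] (q ^ 2) z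
          * qHyp [a ^ 2 / q, b ^ 2 / q] [a ^ 2 * b ^ 2 / q] (q ^ 2) (q * z)
        = prodPrefactor q a b f * ∫ ψ in (-π)..π, prodIntegrand q h a b z f σ ψ) := by
  have hq : q ≠ 0 := norm_pos_iff.1 hq0
  have hQ1 : ‖q ^ 2‖ < 1 := by
    rw [norm_pow]
    exact pow_lt_one₀ (norm_nonneg _) hq1 two_ne_zero
  have hqz : ‖q * z‖ < 1 := by
    rw [norm_mul]
    nlinarith [norm_nonneg q, norm_nonneg z]
  have h0 : h ≠ 0 := by rintro rfl; exact hq (by rw [← hh]; simp)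
  refine ⟨⟨(summable_norm_qHypTerm rfl hQ1 hz).of_norm, (summable_norm_qHypTerm rfl hQ1 hqz).of_norm,
    (summable_norm_qHypTerm rfl hq1 hz).of_norm⟩, qHyp_mul_qHyp hq hq1 hh hz hab, ?_⟩
  intro f σ hf0 hσ hf hC hD hA hB hF hy
  refine ⟨fun ψ => (summable_norm_qHypTerm rfl hQ1 ?_).of_norm, ?_,
    (prodPrefactor_mul_integral hq hq1 hh hz hf0 hσ hf hC hD hA hB hF hy).symm⟩
  · rw [norm_mul, norm_div, mul_comm Complex.I, Complex.norm_exp_ofReal_mul_I, Complex.norm_real,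
      Real.norm_of_nonneg hσ.le, ← div_eq_mul_one_div]
    exact hy
  · rw [funext (prodIntegrand_eq hh h0 hσ)]
    rw [div_eq_mul_inv] at hA hB hF hy
    exact intervalIntegrable_arIntegrand (inv_pos.2 hσ) hQ1 (norm_lt_of_inv hσ hC)
      (norm_lt_of_inv hσ hD) hA hB hF hy _ _
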